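/- Let $N\ge 1$ and $p\ge 0$ be integers, $t\in\mathbb{C}$, and let $M$ be a random $N\times N$ Hermitian matrix whose (unordered) eigenvalues have joint probability density $$\rho(x_1,\dots,x_N)=\frac1{Z}\prod_{1\le i<j\le N}(x_i-x_j)^2\prod_{i=1}^N w(x_i),$$ with $Z$ the normalising constant. $M$ is called a GUE matrix if $w(x)=e^{-x^2/2}$ on $\mathbb{R}$; an LUE matrix with parameter $\gamma>-1$ if $w(x)=x^{\gamma}e^{-x}$ on $(0,\infty)$ and $w=0$ elsewhere; a JUE matrix with parameters $\gamma_1,\gamma_2>-1$ if $w(x)=x^{\gamma_1}(1-x)^{\gamma_2}$ on $[0,1]$ and $w=0$ elsewhere. Write $\lambda=(N^p)=(N,\dots,N)$ ($p$ parts). Let $\nu=(\nu_1\ge\dots\ge\nu_p\ge 0)$ denote a partition with at most $p$ parts, padded with zeros; $\nu\subseteq\lambda$ means $\nu_1\le N$. Put $|\nu|=\sum_j\nu_j$, let $l(\nu)$ be the number of nonzero parts, and let $$\dim V_\nu=|\nu|!\,\frac{\prod_{1\le j<k\le l(\nu)}(\nu_j-\nu_k-j+k)}{\prod_{j=1}^{l(\nu)}(\nu_j+l(\nu)-j)!},\quad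 C_\nu(p)=\prod_{j=1}^p\frac{(\nu_j+p-j)!}{(p-j)!},\quad G_\nu(p,\alpha)=\prod_{j=1}^p\Gamma(\nu_j+p-j+\alpha+1),$$ with $G_0$ the value at the empty partition $\nu=(0,\dots,0)$. With $d_{jk}=\lambda_j-\nu_k-j+k$ for $1\le j,k\le p$, define the $p\times p$ determinants $$D^{(H)}_{\lambda\nu}=\det\left[\mathbf 1_{d_{jk}\ge0,\ d_{jk}\text{ even}}\frac1{(d_{jk}/2)!}\right],\qquad D^{(L)}_{\lambda\nu}=\det\left[\mathbf 1_{d_{jk}\ge0}\frac1{d_{jk}!}\right],$$ $$\tilde{\mathcal D}^{(J)}_{\lambda\nu}=\det\left[\mathbf 1_{d_{jk}\ge0}\frac{\Gamma(2p+\lambda_j+\nu_k-j-k+\gamma_1+\gamma_2+1)}{d_{jk}!}\right].$$ Then $(\det(t-M))^p$ is integrable and its expectation is the following explicit polynomial in $t$. (a) For a GUE matrix, $$\mathbb{E}\left[(\det(t-M))^p\right]=C_\lambda(p)\sum_{\substack{\nu\subseteq\lambda\\ |\lambda|-|\nu|\text{ even}}}\left(\frac{-1}{2}\right)^{\frac{|\lambda|-|\nu|}{2}}\frac{\dim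 V_\nu}{|\nu|!}D^{(H)}_{\lambda\nu}\,t^{|\nu|}.$$ (b) For an LUE matrix with parameter $\gamma>-1$, $$\mathbb{E}\left[(\det(t-M))^p\right]=(-1)^{p(p+N-1)}G_\lambda(p,\gamma)\frac{G_\lambda(p,0)}{G_0(p,0)}\sum_{\nu\subseteq\lambda}\frac{(-1)^{|\nu|}}{|\nu|!\,G_\nu(p,\gamma)}\dim V_\nu\,D^{(L)}_{\lambda\nu}\,t^{|\nu|}.$$ (c) For a JUE matrix with parameters $\gamma_1,\gamma_2>-1$, $$\mathbb{E}\left[(\det(t-M))^p\right]=\left(\prod_{j=N}^{p+N-1}\frac1{\Gamma(2j+\gamma_1+\gamma_2+1)}\right)(-1)^{p(p+N-1)}\frac{G_\lambda(p,\gamma_1)G_\lambda(p,0)}{G_0(p,0)}\sum_{\nu\subseteq\lambda}\frac{(-1)^{|\nu|}}{|\nu|!\,G_\nu(p,\gamma_1)}\dim V_\nu\,\tilde{\mathcal D}^{(J)}_{\lambda\nu}\,t^{|\nu|}.$$ -/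

import Mathlib

open MeasureTheory
open scoped Nat ENNReal

noncomputable section

namespace UnitaryEnsemble

/-! ### The three unitary ensembles -/

/-- The Gaussian weight on the real line. -/
def gaussianWeight (x : ℝ) : ℝ := Real.exp (-x ^ 2 / 2)

/-- The Laguerre weight, supported on the positive half-line. -/
def laguerreWeight (γ : ℝ) : ℝ → ℝ :=
  Set.indicator (Set.Ioi 0) fun x => x ^ γ * Real.exp (-x)

/-- The Jacobi weight, supported on the unit interval. -/
def jacobiWeight (γ₁ γ₂ : ℝ) : ℝ → ℝ :=
  Set.indicator (Set.Icc 0 1) fun x => x ^ γ₁ * (1 - x) ^ γ₂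

/-- The Vandermonde product over pairs `i < j` of `x i - x j`. -/
def vandermonde {N : ℕ} (x : Fin N → ℝ) : ℝ := ∏ i, ∏ j ∈ Finset.Ioi i, (x i - x j)

/-- The density, before normalisation, of the eigenvalues. -/
def unnormalizedDensity {N : ℕ} (w : ℝ → ℝ) (x : Fin N → ℝ) : ℝ :=
  vandermonde x ^ 2 * ∏ i, w (x i)

/-- The normalisation constant. -/
def partitionFunction (N : ℕ) (w : ℝ → ℝ) : ℝ :=
  ∫ x : Fin N → ℝ, unnormalizedDensity w x

/-- The joint probability density function of the (unordered) eigenvalues. -/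
def jpdf {N : ℕ} (w : ℝ → ℝ) (x : Fin N → ℝ) : ℝ :=
  unnormalizedDensity w x / partitionFunction N w

/-- The joint law of the eigenvalues of a random Hermitian matrix, when they are listed in
uniformly random order: the average over all relabellings of the law of one listing. -/
def eigenvalueLaw {Ω : Type*} [MeasurableSpace Ω] {N : ℕ} (P : Measure Ω)
    (M : Ω → Matrix (Fin N) (Fin N) ℂ) (hM : ∀ ω, (M ω).IsHermitian) : Measure (Fin N → ℝ) :=
  ((N ! : ℝ≥0∞)⁻¹) • ∑ σ : Equiv.Perm (Fin N), P.map fun ω i => (hM ω).eigenvalues (σ i)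

/-- `M` is a random `N × N` Hermitian matrix whose unordered eigenvalues have the joint probability
density proportional to `Δ(x)² ∏ w(xᵢ)`. -/
structure IsUnitaryEnsemble {Ω : Type*} [MeasurableSpace Ω] {N : ℕ} (w : ℝ → ℝ) (P : Measure Ω)
    (M : Ω → Matrix (Fin N) (Fin N) ℂ) : Prop where
  aemeasurable : ∀ i j, AEMeasurable (fun ω => M ω i j) P
  isHermitian : ∀ ω, (M ω).IsHermitian
  eigenvalueLaw_eq : eigenvalueLaw P M isHermitian =
    (volume : Measure (Fin N → ℝ)).withDensity fun x => ENNReal.ofReal (jpdf w x)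

/-- GUE matrices. -/
abbrev IsGUE {Ω : Type*} [MeasurableSpace Ω] {N : ℕ} (P : Measure Ω)
    (M : Ω → Matrix (Fin N) (Fin N) ℂ) : Prop :=
  IsUnitaryEnsemble gaussianWeight P M

/-- LUE matrices with parameter `γ`. -/
abbrev IsLUE {Ω : Type*} [MeasurableSpace Ω] {N : ℕ} (γ : ℝ) (P : Measure Ω)
    (M : Ω → Matrix (Fin N) (Fin N) ℂ) : Prop :=
  IsUnitaryEnsemble (laguerreWeight γ) P M

/-- JUE matrices with parameters `γ₁`, `γ₂`. -/
abbrev IsJUE {Ω : Type*} [MeasurableSpace Ω] {N : ℕ} (γ₁ γ₂ : ℝ) (P : Measure Ω)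
    (M : Ω → Matrix (Fin N) (Fin N) ℂ) : Prop :=
  IsUnitaryEnsemble (jacobiWeight γ₁ γ₂) P M

/-! ### Partitions

A partition with at most `n` parts is a weakly decreasing `lam : Fin n → ℕ`, padded with zeros.
The part written `lam_j` with `1 ≤ j ≤ n` on paper is `lam (j - 1)` here. -/

/-- The partitions contained in the rectangle `(N, …, N)` with `p` rows. -/
def subpartitions (N p : ℕ) : Finset (Fin p → ℕ) :=
  open Classical in
  (Fintype.piFinset fun _ : Fin p => Finset.range (N + 1)).filter Antitone

/-- The rectangular partition `(N, …, N)` with `p` rows. -/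
def rect (N p : ℕ) : Fin p → ℕ := fun _ => N

/-- The weight `|lam|`. -/
def weight {n : ℕ} (lam : Fin n → ℕ) : ℕ := ∑ j, lam j

/-- The length: the number of nonzero parts. -/
def length {n : ℕ} (lam : Fin n → ℕ) : ℕ := (Finset.univ.filter fun j => lam j ≠ 0).card

/-- The dimension of the irreducible representation of the symmetric group labelled by `lam`,
given by the formula
`|lam|! ∏_{1 ≤ j < k ≤ l} (lam_j - lam_k - j + k) / ∏_{1 ≤ j ≤ l} (lam_j + l - j)!`,
with `l` the length. Indices at most `l` are those of nonzero parts. -/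
def dimV {n : ℕ} (lam : Fin n → ℕ) : ℝ :=
  ((weight lam)! : ℝ) *
    (∏ j, ∏ k ∈ (Finset.Ioi j).filter (fun k => lam k ≠ 0),
      ((lam j : ℝ) - (lam k : ℝ) - ((j : ℕ) : ℝ) + ((k : ℕ) : ℝ))) /
    ∏ j ∈ Finset.univ.filter (fun j => lam j ≠ 0),
      ((lam j + (length lam - ((j : ℕ) + 1)))! : ℝ)

/-- `C_lam(n) = ∏_{1 ≤ j ≤ n} (lam_j + n - j)! / (n - j)!`. -/
def C {n : ℕ} (lam : Fin n → ℕ) : ℝ :=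
  ∏ j : Fin n, ((lam j + (n - ((j : ℕ) + 1)))! : ℝ) / ((n - ((j : ℕ) + 1))! : ℝ)

/-- `G_lam(n, γ) = ∏_{1 ≤ j ≤ n} Γ(lam_j + n - j + γ + 1)`. -/
def G {n : ℕ} (lam : Fin n → ℕ) (γ : ℝ) : ℝ :=
  ∏ j : Fin n, Real.Gamma ((lam j : ℝ) + (n : ℝ) - (((j : ℕ) : ℝ) + 1) + γ + 1)

/-- The integer `lam_j - nu_k - j + k`. -/
def shift {n : ℕ} (lam nu : Fin n → ℕ) (j k : Fin n) : ℤ :=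
  (lam j : ℤ) - (nu k : ℤ) - ((j : ℕ) : ℤ) + ((k : ℕ) : ℤ)

/-- The determinant of the Hermite case. As usual `1 / m! = 0` for negative integers `m`. -/
def DHermite {n : ℕ} (lam nu : Fin n → ℕ) : ℝ :=
  Matrix.det (Matrix.of fun j k : Fin n =>
    if 0 ≤ shift lam nu j k ∧ Even (shift lam nu j k) then
      (1 : ℝ) / (((shift lam nu j k / 2).toNat)! : ℝ) else 0)

/-- The determinant of the Laguerre case. -/
def DLaguerre {n : ℕ} (lam nu : Fin n → ℕ) : ℝ :=
  Matrix.det (Matrix.of fun j k : Fin n =>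
    if 0 ≤ shift lam nu j k then (1 : ℝ) / (((shift lam nu j k).toNat)! : ℝ) else 0)

/-- The determinant of the Jacobi case, with entries
`Γ(2 n + lam_j + nu_k - j - k + γ₁ + γ₂ + 1) / (lam_j - nu_k - j + k)!`, `1 ≤ j, k ≤ n`. -/
def DJacobi {n : ℕ} (γ₁ γ₂ : ℝ) (lam nu : Fin n → ℕ) : ℝ :=
  Matrix.det (Matrix.of fun j k : Fin n =>
    if 0 ≤ shift lam nu j k then
      Real.Gamma (2 * (n : ℝ) + (lam j : ℝ) + (nu k : ℝ) - (((j : ℕ) : ℝ) + 1)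
        - (((k : ℕ) : ℝ) + 1) + γ₁ + γ₂ + 1) / (((shift lam nu j k).toNat)! : ℝ) else 0)

end UnitaryEnsemble

end

open MeasureTheory
open scoped Nat ENNReal

noncomputable section

namespace UnitaryEnsemble

/-! ### Determinants -/

section Algebra

variable {R : Type*} [CommRing R]

/-! The power of the characteristic polynomial is the confluent case of the average of `∏ i, ∏ k, (t
k - x i)` over the eigenvalue density. Multiplied by the Vandermonde determinants of `x` and `t`,
this product is a Vandermonde determinant in `N + p` variables, so it is a determinant in any monic
polynomials of degrees `0, …, N + p - 1`. Take monomials below degree `N` and orthogonal polynomials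
from `N` on. Integrating against the remaining Vandermonde of `x` (Andréief's identity) makes the
matrix block triangular, and the average becomes `Z * det (P_{N+j}(t k)) / Δ(t)`
(`vandermonde_mul_productAverage`).

The Cauchy–Binet formula expands the numerator in minors of the coefficient matrix times generalised
Vandermonde determinants, that is, `Δ(t)` times Schur polynomials indexed by partitions in the `p ×
N` rectangle. With all `t k = t`, the Schur polynomial is `t ^ |ν|` times `∏_{j<k} (ν_j - ν_k - j +
k) / (k - j)`, which `dimV_div_factorial` rewrites through `dimV` (`productAverage_diagonal`,
`integral_det_pow_eq_sum`). The confluent limit is taken along `t k = t * q ^ k`, `q → 1`.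

It remains to know the orthogonal polynomials. Each coefficient is a row factor times a column
factor times the entry of the determinant in the statement, up to a power of `-1/2` for Hermite.
Laguerre and Jacobi orthogonality holds because an `n`-th finite difference kills polynomials of
degree below `n`; Hermite orthogonality is Gaussian integration by parts. -/

theorem det_vandermonde_append {N p : ℕ} (x : Fin N → R) (t : Fin p → R) :
    (Matrix.vandermonde (Fin.append x t)).det =
      (Matrix.vandermonde x).det * (Matrix.vandermonde t).det * ∏ i, ∏ k, (t k - x i) := by
  have key : ∀ {n : ℕ} (y : Fin n → R), (Matrix.vandermonde y).det =
      ∏ i, ∏ j, if i < j then y j - y i else 1 := by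
    intro n y
    rw [Matrix.det_vandermonde]
    refine Finset.prod_congr rfl fun i _ => ?_
    rw [← Finset.prod_filter]
    congr 1
    ext j
    simp
  rw [key, key, key, Fin.prod_univ_add]
  simp only [Fin.prod_univ_add, Fin.append_left, Fin.append_right]
  have h1 : ∀ (i : Fin N) (k : Fin p), Fin.castAdd p i < Fin.natAdd N k := by
    intro i k
    simp only [Fin.lt_def, Fin.val_castAdd, Fin.val_natAdd]
    omega
  have h2 : ∀ (i : Fin N) (k : Fin p), ¬ Fin.natAdd N k < Fin.castAdd p i := by
    intro i k
    exact not_lt.2 (h1 i k).le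
  have h3 : ∀ i j : Fin N, Fin.castAdd p i < Fin.castAdd p j ↔ i < j := by
    intro i j
    rw [Fin.lt_def, Fin.lt_def]
    simp
  have h4 : ∀ i j : Fin p, Fin.natAdd N i < Fin.natAdd N j ↔ i < j := by
    intro i j
    rw [Fin.lt_def, Fin.lt_def]
    simp
  simp only [h1, h2, h3, h4, if_true, if_false, Finset.prod_const_one, one_mul,
    Finset.prod_mul_distrib]
  ring

theorem det_vandermonde_mul_prod_sub {N p : ℕ} (x : Fin N → R) (t : Fin p → R)
    (Q : Fin N → Polynomial R) (P : Fin p → Polynomial R)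
    (hQ : ∀ i, (Q i).Monic ∧ (Q i).natDegree = i)
    (hP : ∀ j, (P j).Monic ∧ (P j).natDegree = N + j) :
    (Matrix.vandermonde x).det * (Matrix.vandermonde t).det * ∏ i, ∏ k, (t k - x i) =
      (Matrix.of fun a b : Fin N ⊕ Fin p =>
        (Sum.elim Q P b).eval (Sum.elim x t a)).det := by
  rw [← det_vandermonde_append,
    Matrix.det_eval_matrixOfPolynomials_eq_det_vandermonde _ (Fin.append Q P),
    ← Matrix.det_submatrix_equiv_self (finSumFinEquiv (m := N) (n := p))]
  · congr 1
    ext a b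
    rcases a with a | a <;> rcases b with b | b <;> simp
  · intro i
    refine Fin.addCases (fun i => ?_) (fun i => ?_) i
    · simpa using (hQ i).2
    · simpa using (hP i).2
  · intro i
    refine Fin.addCases (fun i => ?_) (fun i => ?_) i
    · simpa using (hQ i).1
    · simpa using (hP i).1

/-- Each row of `A * B` is a linear combination of rows of `B`; expand by multilinearity of the
determinant. -/
theorem det_mul_eq_sum_functions {p : ℕ} {K : Type*} [Fintype K] [DecidableEq K]
    (A : Matrix (Fin p) K R) (B : Matrix K (Fin p) R) :
    (A * B).det = ∑ f : Fin p → K, (∏ i, A i (f i)) * (B.submatrix f id).det := by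
  have h : A * B = fun i => ∑ k, A i k • B k := by
    ext i j
    simp [Matrix.mul_apply]
  rw [h]
  change Matrix.detRowAlternating.toMultilinearMap (fun i => ∑ k, A i k • B k) = _
  rw [MultilinearMap.map_sum]
  refine Finset.sum_congr rfl fun f _ => ?_
  rw [MultilinearMap.map_smul_univ]
  rfl

/-- Functions out of `Fin p` that are injective factor uniquely as a permutation followed by an
order embedding. -/
theorem sum_functions_eq_sum_orderEmbedding {p : ℕ} {K : Type*} [Fintype K] [LinearOrder K]
    {M : Type*} [AddCommMonoid M] (F : (Fin p → K) → M)
    (hF : ∀ f, ¬ Function.Injective f → F f = 0) :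
    ∑ f, F f = ∑ s : Fin p ↪o K, ∑ σ : Equiv.Perm (Fin p), F (s ∘ σ) := by
  classical
  rw [← Fintype.sum_prod_type' (f := fun (s : Fin p ↪o K) (σ : Equiv.Perm (Fin p)) => F (s ∘ σ))]
  symm
  rw [← Finset.sum_filter_of_ne (s := Finset.univ) (p := fun f : Fin p → K => Function.Injective f)
    (f := F) (fun f _ h => by by_contra hf; exact h (hF f hf))]
  refine Finset.sum_bij (fun q _ => q.1 ∘ q.2) ?_ ?_ ?_ ?_
  · intro q _
    simpa using q.1.injective.comp q.2.injective
  · rintro ⟨s, σ⟩ _ ⟨s', σ'⟩ _ h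
    simp only at h
    have hs : s = s' := by
      have hr : Set.range s = Set.range s' := by
        have := congrArg Set.range h
        rwa [σ.surjective.range_comp, σ'.surjective.range_comp] at this
      exact DFunLike.coe_injective (s.strictMono.range_inj s'.strictMono |>.1 hr)
    subst hs
    congr 1
    ext i
    exact congrArg Fin.val (s.injective (congrFun h i))
  · intro f hf
    have hf' : Function.Injective f := by simpa using hf
    refine ⟨(OrderEmbedding.ofStrictMono (f ∘ Tuple.sort f)
      ((Tuple.monotone_sort f).strictMono_of_injective
        (hf'.comp (Tuple.sort f).injective)), (Tuple.sort f)⁻¹), Finset.mem_univ _, ?_⟩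
    funext i
    simp
  · intros
    rfl

/-- A non-injective choice of rows repeats a row and contributes nothing. For an injective choice `s
∘ σ`, sorting the rows of `B` costs the sign of `σ`, and the sum over `σ` is then the Leibniz
expansion of the minor of `A`. -/
theorem cauchyBinet {p : ℕ} {K : Type*} [Fintype K] [LinearOrder K]
    (A : Matrix (Fin p) K R) (B : Matrix K (Fin p) R) :
    (A * B).det = ∑ s : Fin p ↪o K, (A.submatrix id s).det * (B.submatrix s id).det := by
  rw [det_mul_eq_sum_functions, sum_functions_eq_sum_orderEmbedding]
  · refine Finset.sum_congr rfl fun s _ => ?_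
    rw [← Matrix.det_transpose, Matrix.det_apply', Finset.sum_mul]
    refine Finset.sum_congr rfl fun σ _ => ?_
    have : B.submatrix (s ∘ σ) id = (B.submatrix s id).submatrix σ id := by
      ext; rfl
    rw [this, Matrix.det_permute]
    simp only [Function.comp, Matrix.transpose_apply, Matrix.submatrix_apply, id]
    ring
  · intro f hf
    simp only [Function.Injective, not_forall] at hf
    obtain ⟨i, j, hij, hne⟩ := hf
    rw [Matrix.det_zero_of_row_eq hne, mul_zero]
    ext k
    simp [hij]

end Algebra

/-! ### Integrals of determinants -/

/-- Row `i` depends on `x i` alone, so every Leibniz term is a product of one-variable functions and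
Fubini applies. -/
theorem integrable_integral_det {N p : ℕ} (f : Fin N → Fin N ⊕ Fin p → ℝ → ℂ)
    (c : Fin p → Fin N ⊕ Fin p → ℂ) (hf : ∀ i b, Integrable (f i b)) :
    Integrable (fun x : Fin N → ℝ => (Matrix.of fun a b : Fin N ⊕ Fin p =>
      Sum.elim (fun i => f i b (x i)) (fun k => c k b) a).det) ∧
    ∫ x : Fin N → ℝ, (Matrix.of fun a b : Fin N ⊕ Fin p =>
      Sum.elim (fun i => f i b (x i)) (fun k => c k b) a).det =
    (Matrix.of fun a b : Fin N ⊕ Fin p =>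
      Sum.elim (fun i => ∫ y, f i b y) (fun k => c k b) a).det := by
  have expand : ∀ g : Fin N → Fin N ⊕ Fin p → ℂ, (Matrix.of fun a b : Fin N ⊕ Fin p =>
      Sum.elim (fun i => g i b) (fun k => c k b) a).det =
      ∑ σ : Equiv.Perm (Fin N ⊕ Fin p), ((Equiv.Perm.sign σ : ℤ) : ℂ) *
        ((∏ i, g i (σ (Sum.inl i))) * ∏ k, c k (σ (Sum.inr k))) := by
    intro g
    rw [← Matrix.det_transpose, Matrix.det_apply']
    simp [Fintype.prod_sum_type]
  have hint : ∀ σ : Equiv.Perm (Fin N ⊕ Fin p), Integrable fun x : Fin N → ℝ =>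
      ((Equiv.Perm.sign σ : ℤ) : ℂ) *
        ((∏ i, f i (σ (Sum.inl i)) (x i)) * ∏ k, c k (σ (Sum.inr k))) := fun σ =>
    ((Integrable.fintype_prod (f := fun i => f i (σ (Sum.inl i))) fun i => hf i _).mul_const
      _).const_mul _
  constructor
  · simp only [expand]
    exact integrable_finsetSum _ fun σ _ => hint σ
  · simp only [expand]
    rw [integral_finsetSum _ fun σ _ => hint σ]
    refine Finset.sum_congr rfl fun σ _ => ?_
    rw [integral_const_mul, integral_mul_const]
    congr 2
    exact integral_fintype_prod_volume_eq_prod fun i => f i (σ (Sum.inl i))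

/-- Andréief's identity with `p` extra constant rows. Each Leibniz term of the Vandermonde is
absorbed into the rows of the other determinant. After integration the `N !` terms differ only by a
permutation of rows, whose sign cancels the Leibniz sign. -/
theorem integrable_integral_det_mul_vandermonde {N p : ℕ} (w : ℝ → ℂ)
    (q : Fin N ⊕ Fin p → ℝ → ℂ) (c : Fin p → Fin N ⊕ Fin p → ℂ)
    (hq : ∀ (i : Fin N) b, Integrable fun y : ℝ => (y : ℂ) ^ (i : ℕ) * q b y * w y) :
    Integrable (fun x : Fin N → ℝ => (Matrix.of fun a b : Fin N ⊕ Fin p =>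
      Sum.elim (fun i => q b (x i)) (fun k => c k b) a).det *
      (Matrix.vandermonde fun i => (x i : ℂ)).det * ∏ i, w (x i)) ∧
    ∫ x : Fin N → ℝ, (Matrix.of fun a b : Fin N ⊕ Fin p =>
      Sum.elim (fun i => q b (x i)) (fun k => c k b) a).det *
      (Matrix.vandermonde fun i => (x i : ℂ)).det * ∏ i, w (x i) =
    (N ! : ℂ) * (Matrix.of fun a b : Fin N ⊕ Fin p =>
      Sum.elim (fun i : Fin N => ∫ y : ℝ, (y : ℂ) ^ (i : ℕ) * q b y * w y)
        (fun k => c k b) a).det := by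
  have expand : ∀ x : Fin N → ℝ, (Matrix.of fun a b : Fin N ⊕ Fin p =>
      Sum.elim (fun i => q b (x i)) (fun k => c k b) a).det *
      (Matrix.vandermonde fun i => (x i : ℂ)).det * ∏ i, w (x i) =
      ∑ σ : Equiv.Perm (Fin N), ((Equiv.Perm.sign σ : ℤ) : ℂ) *
        (Matrix.of fun a b : Fin N ⊕ Fin p =>
          Sum.elim (fun i => (x i : ℂ) ^ (σ i : ℕ) * q b (x i) * w (x i))
            (fun k => c k b) a).det := by
    intro x
    rw [← Matrix.det_transpose (Matrix.vandermonde _), Matrix.det_apply' (Matrix.transpose _),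
      Finset.mul_sum,
      Finset.sum_mul]
    refine Finset.sum_congr rfl fun σ _ => ?_
    have := Matrix.det_mul_column
      (Sum.elim (fun i => (x i : ℂ) ^ (σ i : ℕ) * w (x i)) fun _ => 1)
      (Matrix.of fun a b : Fin N ⊕ Fin p => Sum.elim (fun i => q b (x i)) (fun k => c k b) a)
    rw [Fintype.prod_sum_type] at this
    simp only [Sum.elim_inl, Sum.elim_inr, Finset.prod_const_one, mul_one] at this
    have h2 : (Matrix.of fun a b : Fin N ⊕ Fin p =>
          Sum.elim (fun i => (x i : ℂ) ^ (σ i : ℕ) * q b (x i) * w (x i))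
            (fun k => c k b) a) = Matrix.of fun a b : Fin N ⊕ Fin p =>
          (Sum.elim (fun i => (x i : ℂ) ^ (σ i : ℕ) * w (x i)) fun _ => 1) a *
          (Matrix.of fun a b : Fin N ⊕ Fin p =>
            Sum.elim (fun i => q b (x i)) (fun k => c k b) a) a b := by
      ext a b
      rcases a with a | a <;> simp
      ring
    rw [h2, this, Finset.prod_mul_distrib]
    simp only [Matrix.transpose_apply, Matrix.vandermonde_apply]
    ring
  have key := fun σ : Equiv.Perm (Fin N) => integrable_integral_det
    (fun i b y => (y : ℂ) ^ (σ i : ℕ) * q b y * w y) c fun i b => hq (σ i) b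
  constructor
  · simp only [expand]
    exact integrable_finsetSum _ fun σ _ => (key σ).1.const_mul _
  · simp only [expand]
    rw [integral_finsetSum _ fun σ _ => (key σ).1.const_mul _]
    have : ∀ σ : Equiv.Perm (Fin N), ∫ x : Fin N → ℝ, ((Equiv.Perm.sign σ : ℤ) : ℂ) *
        (Matrix.of fun a b : Fin N ⊕ Fin p =>
          Sum.elim (fun i => (x i : ℂ) ^ (σ i : ℕ) * q b (x i) * w (x i))
            (fun k => c k b) a).det = (Matrix.of fun a b : Fin N ⊕ Fin p =>
      Sum.elim (fun i : Fin N => ∫ y : ℝ, (y : ℂ) ^ (i : ℕ) * q b y * w y)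
        (fun k => c k b) a).det := by
      intro σ
      rw [integral_const_mul, (key σ).2]
      have h3 : (Matrix.of fun a b : Fin N ⊕ Fin p =>
          Sum.elim (fun i => ∫ y : ℝ, (y : ℂ) ^ (σ i : ℕ) * q b y * w y)
            (fun k => c k b) a) = (Matrix.of fun a b : Fin N ⊕ Fin p =>
          Sum.elim (fun i : Fin N => ∫ y : ℝ, (y : ℂ) ^ (i : ℕ) * q b y * w y)
            (fun k => c k b) a).submatrix (Equiv.Perm.sumCongr σ 1) id := by
        ext a b
        rcases a with a | a <;> simp
      rw [h3, Matrix.det_permute, Equiv.Perm.sign_sumCongr, map_one, mul_one, ← mul_assoc]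
      rcases Int.units_eq_one_or (Equiv.Perm.sign σ) with h | h <;> simp [h]
    simp [this, Fintype.card_perm]

theorem integrable_integral_det_mul_vandermonde_square {N : ℕ} (w : ℝ → ℂ)
    (q : Fin N → ℝ → ℂ)
    (hq : ∀ (i : Fin N) b, Integrable fun y : ℝ => (y : ℂ) ^ (i : ℕ) * q b y * w y) :
    Integrable (fun x : Fin N → ℝ => (Matrix.of fun i b => q b (x i)).det *
      (Matrix.vandermonde fun i => (x i : ℂ)).det * ∏ i, w (x i)) ∧
    ∫ x : Fin N → ℝ, (Matrix.of fun i b => q b (x i)).det *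
      (Matrix.vandermonde fun i => (x i : ℂ)).det * ∏ i, w (x i) =
    (N ! : ℂ) * (Matrix.of fun i b : Fin N => ∫ y : ℝ, (y : ℂ) ^ (i : ℕ) * q b y * w y).det := by
  have h := integrable_integral_det_mul_vandermonde (p := 0) w (Sum.elim q fun _ _ => 0)
    (fun _ _ => 0) (fun i b => by
      rcases b with b | b
      · exact hq i b
      · exact b.elim0)
  have e : ∀ g : Fin N → Fin N → ℂ, (Matrix.of fun a b : Fin N ⊕ Fin 0 =>
      Sum.elim (fun i => Sum.elim (fun b => g i b) (fun _ => 0) b) (fun _ => 0) a).det =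
      (Matrix.of g).det := by
    intro g
    rw [← Matrix.det_submatrix_equiv_self (Equiv.sumEmpty (Fin N) (Fin 0))]
    congr 1
    ext a b
    rcases a with a | a
    · rcases b with b | b
      · simp
      · exact b.elim0
    · exact a.elim0
  have e1 := fun x : Fin N → ℝ => e fun i b => q b (x i)
  have e2 := e fun i b => ∫ y : ℝ, (y : ℂ) ^ (i : ℕ) * q b y * w y
  have e1' : ∀ x : Fin N → ℝ, (Matrix.of fun a b : Fin N ⊕ Fin 0 =>
      Sum.elim (fun i => (Sum.elim q (fun _ _ => 0) b : ℝ → ℂ) (x i)) (fun _ => 0) a).det =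
      (Matrix.of fun i b => q b (x i)).det := by
    intro x
    rw [← e1]
    congr 1
    ext a b
    rcases a with a | a <;> rcases b with b | b <;> simp
  have e2' : (Matrix.of fun a b : Fin N ⊕ Fin 0 =>
      Sum.elim (fun i : Fin N => ∫ y : ℝ, (y : ℂ) ^ (i : ℕ) *
        (Sum.elim q (fun _ _ => 0) b : ℝ → ℂ) y * w y) (fun _ => 0) a).det =
      (Matrix.of fun i b : Fin N => ∫ y : ℝ, (y : ℂ) ^ (i : ℕ) * q b y * w y).det := by
    rw [← e2]
    congr 1
    ext a b
    rcases a with a | a <;> rcases b with b | b <;> simp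
  simp only [e1', e2'] at h
  exact h

/-! ### Averages of products of characteristic polynomials. -/

theorem integrable_eval_mul {w : ℝ → ℝ} (hw : ∀ k : ℕ, Integrable fun y => y ^ k * w y)
    (P : Polynomial ℂ) : Integrable fun y : ℝ => P.eval (y : ℂ) * (w y : ℂ) := by
  simp only [Polynomial.eval_eq_sum_range, Finset.sum_mul]
  refine integrable_finsetSum _ fun k _ => ?_
  have := ((hw k).ofReal (𝕜 := ℂ)).const_mul (P.coeff k)
  refine this.congr (ae_of_all _ fun y => ?_)
  simp
  ring

/-- The average, before normalisation, of the product of the characteristic polynomials at the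
points `t k`. -/
def productAverage (N : ℕ) {p : ℕ} (w : ℝ → ℝ) (t : Fin p → ℂ) : ℂ :=
  ∫ x : Fin N → ℝ, (∏ i, ∏ k, (t k - (x i : ℂ))) * (unnormalizedDensity w x : ℂ)

theorem unnormalizedDensity_eq {N : ℕ} (w : ℝ → ℝ) (x : Fin N → ℝ) :
    (unnormalizedDensity w x : ℂ) =
      (Matrix.vandermonde fun i => (x i : ℂ)).det * (Matrix.vandermonde fun i => (x i : ℂ)).det *
        ∏ i, (w (x i) : ℂ) := by
  have h : vandermonde x ^ 2 = (Matrix.vandermonde x).det ^ 2 := by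
    rw [vandermonde, Matrix.det_vandermonde]
    simp only [← Finset.prod_pow]
    exact Finset.prod_congr rfl fun i _ => Finset.prod_congr rfl fun j _ => by ring
  rw [unnormalizedDensity, h, Matrix.det_vandermonde, Matrix.det_vandermonde]
  push_cast
  ring

/-- The factor `∏ k, (t k - x i)` is absorbed into row `i` of one Vandermonde. The resulting Hankel
determinant gives continuity in `t` and, for `p = 0`, the partition function. -/
theorem integrable_productAverage {N p : ℕ} {w : ℝ → ℝ}
    (hw : ∀ k : ℕ, Integrable fun y => y ^ k * w y) (t : Fin p → ℂ) :
    Integrable (fun x : Fin N → ℝ =>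
      (∏ i, ∏ k, (t k - (x i : ℂ))) * (unnormalizedDensity w x : ℂ)) ∧
    productAverage N w t = (N ! : ℂ) * (Matrix.of fun i b : Fin N =>
      ∫ y : ℝ, (y : ℂ) ^ (i : ℕ) * (y ^ (b : ℕ) * ∏ k, (t k - (y : ℂ))) * (w y : ℂ)).det := by
  have h := integrable_integral_det_mul_vandermonde_square (N := N) (fun y => (w y : ℂ))
    (fun b y => (y : ℂ) ^ (b : ℕ) * ∏ k, (t k - (y : ℂ))) fun i b => by
      have := integrable_eval_mul hw (Polynomial.X ^ (i : ℕ) * (Polynomial.X ^ (b : ℕ) *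
        ∏ k, (Polynomial.C (t k) - Polynomial.X)))
      simpa [Polynomial.eval_prod] using this
  have e : ∀ x : Fin N → ℝ, (Matrix.of fun i b : Fin N =>
      (x i : ℂ) ^ (b : ℕ) * ∏ k, (t k - (x i : ℂ))).det *
      (Matrix.vandermonde fun i => (x i : ℂ)).det * ∏ i, (w (x i) : ℂ) =
      (∏ i, ∏ k, (t k - (x i : ℂ))) * (unnormalizedDensity w x : ℂ) := by
    intro x
    have := Matrix.det_mul_column (fun i => ∏ k, (t k - (x i : ℂ)))
      (Matrix.vandermonde fun i => (x i : ℂ))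
    simp only [Matrix.vandermonde_apply, mul_comm (∏ k, _) ((_ : ℂ) ^ _)] at this
    rw [this, unnormalizedDensity_eq]
    ring
  simp only [e] at h
  exact h

theorem continuous_productAverage {N p : ℕ} {w : ℝ → ℝ}
    (hw : ∀ k : ℕ, Integrable fun y => y ^ k * w y) :
    Continuous fun t : Fin p → ℂ => productAverage N w t := by
  simp only [fun t : Fin p → ℂ => (integrable_productAverage (N := N) hw t).2]
  refine continuous_const.mul (Continuous.matrix_det ?_)
  refine continuous_matrix fun i b => ?_
  -- Each entry is a polynomial in the `t k` whose coefficients are moments of `w`.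
  have e : ∀ t : Fin p → ℂ,
      ∫ y : ℝ, (y : ℂ) ^ (i : ℕ) * (y ^ (b : ℕ) * ∏ k, (t k - (y : ℂ))) * (w y : ℂ) =
      ∑ s ∈ (Finset.univ : Finset (Fin p)).powerset, (∏ k ∈ s, t k) *
        ∫ y : ℝ, ((y : ℂ) ^ (i + b : ℕ) * (-y) ^ (Finset.univ \ s).card) * (w y : ℂ) := by
    intro t
    simp only [← integral_const_mul]
    rw [← integral_finsetSum]
    · refine integral_congr_ae (ae_of_all _ fun y => ?_)
      simp only [sub_eq_add_neg, Finset.prod_add, Finset.prod_const, Finset.mul_sum,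
        Finset.sum_mul]
      exact Finset.sum_congr rfl fun s _ => by ring
    · intro s _
      refine Integrable.const_mul ?_ _
      have := integrable_eval_mul hw (Polynomial.X ^ (i + b : ℕ) *
        (-Polynomial.X) ^ (Finset.univ \ s).card)
      simpa using this
  simp only [Matrix.of_apply, e]
  fun_prop

/-- Keeping the Vandermonde of `t` on the left avoids any division, so no distinctness of the `t k`
is needed. -/
theorem vandermonde_mul_productAverage {N p : ℕ} {w : ℝ → ℝ}
    (hw : ∀ k : ℕ, Integrable fun y => y ^ k * w y)
    (t : Fin p → ℂ) (P : Fin p → Polynomial ℂ)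
    (hP : ∀ j, (P j).Monic ∧ (P j).natDegree = N + j)
    (horth : ∀ (i : Fin N) j, ∫ y : ℝ, (y : ℂ) ^ (i : ℕ) * (P j).eval (y : ℂ) * (w y : ℂ) = 0) :
    (Matrix.vandermonde t).det * productAverage N w t =
      (partitionFunction N w : ℂ) * (Matrix.of fun k j => (P j).eval (t k)).det := by
  set Q : Fin N → Polynomial ℂ := fun i => Polynomial.X ^ (i : ℕ) with hQ
  have h := (integrable_integral_det_mul_vandermonde (N := N) (p := p) (fun y => (w y : ℂ))
    (fun b y => (Sum.elim Q P b).eval (y : ℂ)) (fun k b => (Sum.elim Q P b).eval (t k))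
    fun i b => by
      have := integrable_eval_mul hw (Polynomial.X ^ (i : ℕ) * Sum.elim Q P b)
      simpa using this).2
  have e : ∀ x : Fin N → ℝ, (Matrix.of fun a b : Fin N ⊕ Fin p =>
      Sum.elim (fun i => (Sum.elim Q P b).eval (x i : ℂ))
        (fun k => (Sum.elim Q P b).eval (t k)) a).det *
      (Matrix.vandermonde fun i => (x i : ℂ)).det * ∏ i, (w (x i) : ℂ) =
      (Matrix.vandermonde t).det *
        ((∏ i, ∏ k, (t k - (x i : ℂ))) * (unnormalizedDensity w x : ℂ)) := by
    intro x
    have h1 := det_vandermonde_mul_prod_sub (fun i => (x i : ℂ)) t Q P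
      (fun i => ⟨Polynomial.monic_X_pow _, Polynomial.natDegree_X_pow _⟩) hP
    have h2 : (Matrix.of fun a b : Fin N ⊕ Fin p =>
      Sum.elim (fun i => (Sum.elim Q P b).eval (x i : ℂ))
        (fun k => (Sum.elim Q P b).eval (t k)) a) = Matrix.of fun a b : Fin N ⊕ Fin p =>
        (Sum.elim Q P b).eval (Sum.elim (fun i => (x i : ℂ)) t a) := by
      ext a b
      rcases a with a | a <;> simp
    rw [h2, ← h1, unnormalizedDensity_eq]
    ring
  simp only [e] at h
  rw [integral_const_mul] at h
  change _ * productAverage N w t = _ at h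
  rw [h]
  -- The `N × N` moment determinant is never evaluated: the case `p = 0` identifies it with `Z / N
  -- !`.
  have h0 := (integrable_productAverage (N := N) (p := 0) hw Fin.elim0).2
  have hZ : productAverage N w (Fin.elim0 : Fin 0 → ℂ) = (partitionFunction N w : ℂ) := by
    simp only [productAverage, partitionFunction]
    rw [← integral_complex_ofReal]
    simp
  rw [hZ] at h0
  rw [h0, mul_assoc]
  congr 1
  -- Orthogonality makes the upper right block vanish.
  have hb : (Matrix.of fun a b : Fin N ⊕ Fin p => Sum.elim
      (fun i : Fin N => ∫ y : ℝ, (y : ℂ) ^ (i : ℕ) * (Sum.elim Q P b).eval (y : ℂ) * (w y : ℂ))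
      (fun k => (Sum.elim Q P b).eval (t k)) a) =
      Matrix.fromBlocks (Matrix.of fun i b : Fin N =>
        ∫ y : ℝ, (y : ℂ) ^ (i : ℕ) * (y ^ (b : ℕ) * ∏ k : Fin 0, (Fin.elim0 k - (y : ℂ))) *
          (w y : ℂ)) 0 (Matrix.of fun k b => (Q b).eval (t k))
        (Matrix.of fun k j => (P j).eval (t k)) := by
    ext a b
    rcases a with a | a <;> rcases b with b | b <;> simp [hQ, horth]
  rw [hb, Matrix.det_fromBlocks_zero₁₂]

/-! ### Strictly increasing sequences and partitions in a rectangle. -/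

theorem StrictMono.add_le_add_of_fin {p : ℕ} {u : Fin p → ℕ} (hu : StrictMono u) {i j : Fin p}
    (hij : i ≤ j) : u i + j ≤ u j + i := by
  obtain ⟨d, hd⟩ := Nat.exists_eq_add_of_le (Fin.le_def.1 hij)
  induction d generalizing j with
  | zero =>
    have : i = j := Fin.ext (by omega)
    subst this
    exact le_rfl
  | succ d ih =>
    have hj : (i : ℕ) + d < p := by omega
    have h1 := ih (j := ⟨i + d, hj⟩) (Fin.le_def.2 (by simp)) (by simp)
    have h2 : u ⟨i + d, hj⟩ < u j := hu (Fin.lt_def.2 (by simp; omega))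
    simp only at h1
    omega

theorem mem_subpartitions {N p : ℕ} {nu : Fin p → ℕ} :
    nu ∈ subpartitions N p ↔ (∀ j, nu j ≤ N) ∧ Antitone nu := by
  simp [subpartitions]

/-- Strictly increasing sequences of length `p` below `N + p` correspond to the partitions
contained in a `p × N` rectangle. -/
theorem sum_orderEmbedding_eq_sum_subpartitions {N p : ℕ} {M : Type*} [AddCommMonoid M]
    (F : (Fin p → ℕ) → M) :
    ∑ s : Fin p ↪o Fin (N + p), F (fun j => s j) =
      ∑ nu ∈ subpartitions N p, F fun j => nu j.rev + j := by
  have hmono : ∀ s : Fin p ↪o Fin (N + p), StrictMono fun j => (s j : ℕ) := fun s i j h =>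
    Fin.lt_def.1 (s.strictMono h)
  have hge : ∀ (s : Fin p ↪o Fin (N + p)) (j : Fin p), (j : ℕ) ≤ s j := by
    intro s j
    have := StrictMono.add_le_add_of_fin (hmono s) (i := ⟨0, j.pos⟩) (j := j)
      (Fin.le_def.2 (Nat.zero_le _))
    simp only at this
    omega
  have hle : ∀ (s : Fin p ↪o Fin (N + p)) (j : Fin p), (s j : ℕ) ≤ N + j := by
    intro s j
    have hj := j.isLt
    have := StrictMono.add_le_add_of_fin (hmono s) (i := j) (j := ⟨p - 1, by omega⟩)
      (Fin.le_def.2 (by simp only; omega))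
    have h2 := (s ⟨p - 1, by omega⟩).isLt
    simp only at this
    omega
  -- Indices are reversed because embeddings increase while partitions decrease; `hge` keeps the
  -- subtraction from truncating.
  refine Finset.sum_bij (fun s _ k => (s k.rev : ℕ) - (k.rev : ℕ)) ?_ ?_ ?_ ?_
  · intro s _
    rw [mem_subpartitions]
    refine ⟨fun j => ?_, fun i j hij => ?_⟩
    · have := hle s j.rev
      omega
    · have := StrictMono.add_le_add_of_fin (hmono s) (Fin.rev_le_rev.2 hij)
      have h1 := hge s i.rev
      have h2 := hge s j.rev
      simp only at this ⊢
      omega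
  · intro s _ s' _ h
    ext j
    have h0 := congrFun h j.rev
    simp only [Fin.rev_rev] at h0
    have h1 := hge s j
    have h2 := hge s' j
    omega
  · intro nu hnu
    rw [mem_subpartitions] at hnu
    refine ⟨OrderEmbedding.ofStrictMono
      (fun j => ⟨nu j.rev + j, by have := hnu.1 j.rev; have := j.isLt; omega⟩) ?_,
      Finset.mem_univ _, ?_⟩
    · intro i j hij
      have := hnu.2 (Fin.rev_le_rev.2 hij.le)
      have h2 := Fin.lt_def.1 hij
      rw [Fin.lt_def]
      simp only
      omega
    · funext k
      change nu k.rev.rev + (k.rev : ℕ) - (k.rev : ℕ) = nu k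
      simp
  · intro s _
    congr 1
    funext j
    have := hge s j
    simp only [Fin.rev_rev]
    omega

/-! ### The confluent limit. -/

/-- The polynomial `1 + q + ⋯ + q ^ (a - 1)`. -/
def qNumber (q : ℂ) (a : ℕ) : ℂ := ∑ i ∈ Finset.range a, q ^ i

theorem pow_sub_pow_eq_qNumber (q : ℂ) (a b : ℕ) :
    q ^ a - q ^ b = (q - 1) * (qNumber q a - qNumber q b) := by
  have ha := mul_geom_sum q a
  have hb := mul_geom_sum q b
  simp only [qNumber]
  linear_combination hb - ha

theorem continuous_qNumber (a : ℕ) : Continuous fun q => qNumber q a := by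
  unfold qNumber
  fun_prop

theorem qNumber_one (a : ℕ) : qNumber 1 a = a := by
  simp [qNumber]

/-- At points in geometric progression a generalised Vandermonde is an ordinary one in the variables
`q ^ u j`. The power of `q - 1` that comes out does not depend on `u`, so it can be cancelled from a
sum over several `u`. -/
theorem det_geometric_pow {p : ℕ} (t q : ℂ) (u : Fin p → ℕ) :
    (Matrix.of fun j k : Fin p => (t * q ^ (k : ℕ)) ^ u j).det =
      (q - 1) ^ (∑ i : Fin p, (Finset.Ioi i).card) *
      ((∏ j, t ^ u j) * ∏ i, ∏ j ∈ Finset.Ioi i, (qNumber q (u j) - qNumber q (u i))) := by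
  have h := Matrix.det_mul_column (fun j => t ^ u j) (Matrix.vandermonde fun j => q ^ u j)
  have e : (Matrix.of fun j k : Fin p => (t * q ^ (k : ℕ)) ^ u j) = Matrix.of fun j k =>
      t ^ u j * (Matrix.vandermonde fun j => q ^ u j) j k := by
    ext j k
    simp only [Matrix.of_apply, Matrix.vandermonde_apply, mul_pow, ← pow_mul, mul_comm (k : ℕ)]
  rw [e, h, Matrix.det_vandermonde]
  simp only [pow_sub_pow_eq_qNumber, Finset.prod_mul_distrib, Finset.prod_const,
    Finset.prod_pow_eq_pow_sum]
  ring

/-- The quotient of the two `F t 1` factors is the Schur polynomial at `(t, …, t)`, given by Weyl's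
dimension formula. -/
theorem productAverage_diagonal {N p : ℕ} {w : ℝ → ℝ}
    (hw : ∀ k : ℕ, Integrable fun y => y ^ k * w y) (t : ℂ) (P : Fin p → Polynomial ℂ)
    (hP : ∀ j, (P j).Monic ∧ (P j).natDegree = N + j)
    (horth : ∀ (i : Fin N) j, ∫ y : ℝ, (y : ℂ) ^ (i : ℕ) * (P j).eval (y : ℂ) * (w y : ℂ) = 0) :
    productAverage N w (fun _ : Fin p => t) = (partitionFunction N w : ℂ) *
      ∑ nu ∈ subpartitions N p,
        (Matrix.of fun j k : Fin p => (P j.rev).coeff (nu k + k.rev)).det *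
        (∏ j : Fin p, ∏ k ∈ Finset.Ioi j,
          (((nu j : ℂ) - nu k - (j : ℕ) + (k : ℕ)) / ((k : ℕ) - (j : ℕ)))) * t ^ weight nu := by
  set n : ℕ := ∑ i : Fin p, (Finset.Ioi i).card with hn
  set F : ℂ → ℂ → (Fin p → ℕ) → ℂ := fun t q u =>
    (∏ j, t ^ u j) * ∏ i, ∏ j ∈ Finset.Ioi i, (qNumber q (u j) - qNumber q (u i)) with hF
  have h1 : ∀ t q : ℂ, (q - 1) ^ n * (F t q (fun j => j) *
      productAverage N w (fun k : Fin p => t * q ^ (k : ℕ))) = (q - 1) ^ n *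
      ((partitionFunction N w : ℂ) * ∑ s : Fin p ↪o Fin (N + p),
        (Matrix.of fun j k : Fin p => (P j).coeff (s k : ℕ)).det * F t q (fun j => s j)) := by
    intro t q
    have h := vandermonde_mul_productAverage hw (fun k : Fin p => t * q ^ (k : ℕ)) P hP horth
    rw [← Matrix.det_transpose] at h
    have e1 := det_geometric_pow t q fun j : Fin p => (j : ℕ)
    rw [show (Matrix.vandermonde fun k : Fin p => t * q ^ (k : ℕ)).transpose =
      Matrix.of fun j k : Fin p => (t * q ^ (k : ℕ)) ^ (j : ℕ) from by
        ext j k; simp [Matrix.vandermonde_apply], e1, mul_assoc] at h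
    refine h.trans ?_
    have e2 : (Matrix.of fun k j : Fin p => (P j).eval (t * q ^ (k : ℕ))).transpose =
        (Matrix.of fun (j : Fin p) (m : Fin (N + p)) => (P j).coeff (m : ℕ)) *
          (Matrix.of fun (m : Fin (N + p)) (k : Fin p) => (t * q ^ (k : ℕ)) ^ (m : ℕ)) := by
      ext j k
      simp only [Matrix.transpose_apply, Matrix.of_apply, Matrix.mul_apply]
      rw [Polynomial.eval_eq_sum_range' (n := N + p) (by rw [(hP j).2]; omega)]
      exact Finset.sum_range _
    rw [← Matrix.det_transpose, e2, cauchyBinet, mul_left_comm, Finset.mul_sum (a := (q - 1) ^ n)]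
    congr 1
    refine Finset.sum_congr rfl fun s _ => ?_
    have e3 := det_geometric_pow t q fun j : Fin p => (s j : ℕ)
    rw [mul_left_comm]
    exact congrArg₂ (· * ·) rfl e3
  have hFq : ∀ t u, Continuous fun q => F t q u := fun t u => by
    simp only [hF]
    refine continuous_const.mul ?_
    exact continuous_finsetProd _ fun i _ => continuous_finsetProd _ fun j _ =>
      (continuous_qNumber _).sub (continuous_qNumber _)
  have h2 : ∀ t, F t 1 (fun j => j) * productAverage N w (fun k : Fin p => t) =
      (partitionFunction N w : ℂ) * ∑ s : Fin p ↪o Fin (N + p),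
        (Matrix.of fun j k : Fin p => (P j).coeff (s k : ℕ)).det * F t 1 (fun j => s j) := by
    intro t
    -- Cancel the power of `q - 1` for `q ≠ 1`, then reach `q = 1` by continuity.
    have := Continuous.ext_on (dense_compl_singleton (1 : ℂ))
      (f := fun q => F t q (fun j => j) *
        productAverage N w (fun k : Fin p => t * q ^ (k : ℕ)))
      (g := fun q => (partitionFunction N w : ℂ) * ∑ s : Fin p ↪o Fin (N + p),
        (Matrix.of fun j k : Fin p => (P j).coeff (s k : ℕ)).det * F t q (fun j => s j))
      ((hFq _ _).mul ((continuous_productAverage hw).comp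
        (continuous_pi fun k => by fun_prop)))
      (continuous_const.mul (continuous_finsetSum _ fun s _ => continuous_const.mul (hFq _ _)))
      (fun q hq => mul_left_cancel₀ (pow_ne_zero n (sub_ne_zero.2 hq)) (h1 t q))
    simpa using congrFun this 1
  set D : ℂ := ∏ i : Fin p, ∏ j ∈ Finset.Ioi i, (((j : ℕ) : ℂ) - (i : ℕ)) with hD
  have hD0 : D ≠ 0 := by
    refine Finset.prod_ne_zero_iff.2 fun i _ => Finset.prod_ne_zero_iff.2 fun j hj => ?_
    rw [sub_ne_zero, Ne, Nat.cast_inj]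
    have := Fin.lt_def.1 (Finset.mem_Ioi.1 hj)
    omega
  have hrev : ∀ f : Fin p → Fin p → ℂ, ∏ i : Fin p, ∏ j ∈ Finset.Ioi i, f j.rev i.rev =
      ∏ i : Fin p, ∏ j ∈ Finset.Ioi i, f i j := by
    intro f
    rw [Finset.prod_sigma', Finset.prod_sigma']
    refine Finset.prod_bij' (fun a _ => ⟨a.2.rev, a.1.rev⟩) (fun a _ => ⟨a.2.rev, a.1.rev⟩)
      ?_ ?_ ?_ ?_ ?_ <;> simp [Fin.rev_lt_rev]
  have h3 : ∀ t, (∏ j : Fin p, t ^ (j : ℕ)) * productAverage N w (fun k : Fin p => t) =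
      (∏ j : Fin p, t ^ (j : ℕ)) * ((partitionFunction N w : ℂ) *
      ∑ nu ∈ subpartitions N p,
        (Matrix.of fun j k : Fin p => (P j.rev).coeff (nu k + k.rev)).det *
        (∏ j : Fin p, ∏ k ∈ Finset.Ioi j,
          (((nu j : ℂ) - nu k - (j : ℕ) + (k : ℕ)) / ((k : ℕ) - (j : ℕ)))) * t ^ weight nu) := by
    intro t
    refine mul_left_cancel₀ hD0 ?_
    have h := h2 t
    have hs := sum_orderEmbedding_eq_sum_subpartitions (N := N) (p := p) fun u =>
      (Matrix.of fun j k : Fin p => (P j).coeff (u k)).det * F t 1 u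
    rw [hs] at h
    have e1 : F t 1 (fun j => j) = (∏ j : Fin p, t ^ (j : ℕ)) * D := by
      simp only [hF, qNumber_one, hD]
    rw [e1] at h
    rw [← mul_assoc, mul_comm D, h, ← mul_assoc, mul_left_comm]
    congr 1
    rw [Finset.mul_sum]
    refine Finset.sum_congr rfl fun nu _ => ?_
    have e2 : (Matrix.of fun j k : Fin p => (P j.rev).coeff (nu k + k.rev)).det =
        (Matrix.of fun j k : Fin p => (P j).coeff (nu k.rev + k)).det := by
      rw [← Matrix.det_submatrix_equiv_self Fin.revPerm]
      congr 1
      ext j k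
      change (P j.rev.rev).coeff (nu k.rev + (k.rev.rev : ℕ)) = _
      rw [Fin.rev_rev, Fin.rev_rev]
      rfl
    have e3 : (∏ j : Fin p, t ^ (nu j.rev + (j : ℕ))) = (∏ j : Fin p, t ^ (j : ℕ)) *
        t ^ weight nu := by
      simp only [pow_add, Finset.prod_mul_distrib]
      rw [mul_comm, weight, ← Finset.prod_pow_eq_pow_sum]
      congr 1
      exact Fintype.prod_equiv Fin.revPerm _ _ fun j => rfl
    have e4 : ∏ i : Fin p, ∏ j ∈ Finset.Ioi i,
        (qNumber 1 (nu j.rev + j) - qNumber 1 (nu i.rev + i)) = D *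
        ∏ j : Fin p, ∏ k ∈ Finset.Ioi j,
          (((nu j : ℂ) - nu k - (j : ℕ) + (k : ℕ)) / ((k : ℕ) - (j : ℕ))) := by
      rw [← hrev fun i j => qNumber 1 (nu j.rev + j) - qNumber 1 (nu i.rev + i), hD]
      simp only [← Finset.prod_mul_distrib]
      refine Finset.prod_congr rfl fun i _ => Finset.prod_congr rfl fun j hj => ?_
      have hlt := Fin.lt_def.1 (Finset.mem_Ioi.1 hj)
      have hne : ((j : ℕ) : ℂ) - (i : ℕ) ≠ 0 := by
        rw [sub_ne_zero, Ne, Nat.cast_inj]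
        omega
      have hi := i.isLt
      have hj := j.isLt
      have c1 : ((i.rev : ℕ) : ℂ) = p - 1 - (i : ℕ) := by
        rw [Fin.val_rev, Nat.cast_sub (by omega)]
        push_cast
        ring
      have c2 : ((j.rev : ℕ) : ℂ) = p - 1 - (j : ℕ) := by
        rw [Fin.val_rev, Nat.cast_sub (by omega)]
        push_cast
        ring
      simp only [qNumber_one, Fin.rev_rev]
      push_cast
      rw [c1, c2]
      field_simp
      ring
    simp only [hF]
    rw [e2, e3, e4]
    ring
  -- The factor `∏ j, t ^ j` vanishes at `t = 0` when `p ≥ 2`; continuity recovers that point.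
  have h4 := Continuous.ext_on (dense_compl_singleton (0 : ℂ))
    (f := fun t => productAverage N w (fun _ : Fin p => t))
    (g := fun t => (partitionFunction N w : ℂ) *
      ∑ nu ∈ subpartitions N p,
        (Matrix.of fun j k : Fin p => (P j.rev).coeff (nu k + k.rev)).det *
        (∏ j : Fin p, ∏ k ∈ Finset.Ioi j,
          (((nu j : ℂ) - nu k - (j : ℕ) + (k : ℕ)) / ((k : ℕ) - (j : ℕ)))) * t ^ weight nu)
    ((continuous_productAverage hw).comp (continuous_pi fun k => continuous_id))
    (by fun_prop)
    (fun t ht => mul_left_cancel₀ (Finset.prod_ne_zero_iff.2 fun j _ => pow_ne_zero _ ht) (h3 t))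
  exact congrFun h4 t

/-! ### From the random matrix to the eigenvalue density. -/

theorem det_smul_one_sub_eq_prod {N : ℕ} {A : Matrix (Fin N) (Fin N) ℂ} (hA : A.IsHermitian)
    (t : ℂ) : (t • (1 : Matrix (Fin N) (Fin N) ℂ) - A).det =
      ∏ i, (t - (hA.eigenvalues i : ℂ)) := by
  have h := congrArg (Polynomial.eval t) hA.charpoly_eq
  rw [Matrix.eval_charpoly] at h
  rw [Matrix.smul_one_eq_diagonal]
  simpa [Polynomial.eval_prod] using h

/-- Conditions on a weight under which the associated ensemble has all moments. -/
structure IsWeight (w : ℝ → ℝ) : Prop where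
  measurable : Measurable w
  nonneg : ∀ x, 0 ≤ w x
  pos : ∀ x ∈ Set.Ioo (0 : ℝ) 1, 0 < w x
  moments : ∀ k : ℕ, Integrable fun y => y ^ k * w y

namespace IsWeight

variable {w : ℝ → ℝ} {N : ℕ}

theorem measurable_unnormalizedDensity (hw : IsWeight w) :
    Measurable fun x : Fin N → ℝ => unnormalizedDensity w x := by
  have := hw.measurable
  unfold unnormalizedDensity vandermonde
  fun_prop

theorem unnormalizedDensity_nonneg (hw : IsWeight w) (x : Fin N → ℝ) :
    0 ≤ unnormalizedDensity w x :=
  mul_nonneg (sq_nonneg _) (Finset.prod_nonneg fun _ _ => hw.nonneg _)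

theorem integrable_unnormalizedDensity (hw : IsWeight w) :
    Integrable fun x : Fin N → ℝ => unnormalizedDensity w x := by
  have := (integrable_productAverage (N := N) (p := 0) hw.moments Fin.elim0).1.re
  simpa using this

/-- The density is positive on the nonempty open set of points with distinct coordinates in `(0,
1)`, an interval on which all three weights are positive. -/
theorem partitionFunction_pos (hw : IsWeight w) : 0 < partitionFunction N w := by
  rw [partitionFunction, integral_pos_iff_support_of_nonneg hw.unnormalizedDensity_nonneg
    hw.integrable_unnormalizedDensity]
  set U : Set (Fin N → ℝ) := {x | (∀ i, x i ∈ Set.Ioo (0 : ℝ) 1) ∧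
    ∀ i, ∀ j, i ≠ j → x i ≠ x j} with hU
  have hopen : IsOpen U := by
    rw [hU, Set.ofPred_and, Set.ofPred_forall, Set.ofPred_forall]
    refine IsOpen.inter (isOpen_iInter_of_finite fun i =>
      isOpen_Ioo.preimage (continuous_apply i)) (isOpen_iInter_of_finite fun i => ?_)
    rw [Set.ofPred_forall]
    refine isOpen_iInter_of_finite fun j => ?_
    by_cases h : i = j
    · simp [h]
    · simpa [h] using isOpen_ne_fun (continuous_apply i) (continuous_apply j)
  have hne : U.Nonempty := by
    refine ⟨fun i => ((i : ℕ) + 1) / ((N : ℝ) + 1), fun i => ⟨by positivity, ?_⟩,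
      fun i j hij h => hij ?_⟩
    · rw [div_lt_one (by positivity)]
      have : ((i : ℕ) : ℝ) < N := by exact_mod_cast i.isLt
      linarith
    · have hN : (N : ℝ) + 1 ≠ 0 := by positivity
      rw [div_left_inj' hN] at h
      have : ((i : ℕ) : ℝ) = (j : ℕ) := by linarith
      exact Fin.ext (by exact_mod_cast this)
  refine lt_of_lt_of_le (hopen.measure_pos volume hne) (measure_mono fun x hx => ?_)
  rw [Function.mem_support, unnormalizedDensity]
  refine mul_ne_zero (pow_ne_zero _ ?_) ?_
  · refine Finset.prod_ne_zero_iff.2 fun i _ => Finset.prod_ne_zero_iff.2 fun j hj => ?_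
    exact sub_ne_zero.2 (hx.2 i j (Finset.mem_Ioi.1 hj).ne)
  · exact Finset.prod_ne_zero_iff.2 fun i _ => (hw.pos _ (hx.1 i)).ne'

theorem lintegral_jpdf (hw : IsWeight w) :
    ∫⁻ x : Fin N → ℝ, ENNReal.ofReal (jpdf w x) = 1 := by
  have hZ := hw.partitionFunction_pos (N := N)
  rw [← ofReal_integral_eq_lintegral_ofReal]
  · simp only [jpdf]
    rw [integral_div]
    change ENNReal.ofReal (partitionFunction N w / partitionFunction N w) = 1
    rw [div_self hZ.ne', ENNReal.ofReal_one]
  · exact hw.integrable_unnormalizedDensity.div_const _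
  · exact ae_of_all _ fun x => div_nonneg (hw.unnormalizedDensity_nonneg x) hZ.le

end IsWeight

section Ensemble

variable {Ω : Type*} [MeasurableSpace Ω] {P : Measure Ω} {N : ℕ} {w : ℝ → ℝ}
  {M : Ω → Matrix (Fin N) (Fin N) ℂ}

/-- `Measure.map` along a function that is not a.e. measurable is zero. If no listing of the
eigenvalues were measurable, their law would vanish, yet it has mass one. One measurable listing
makes every coordinate, hence every listing, measurable. -/
theorem IsUnitaryEnsemble.aemeasurable_eigenvalues (hM : IsUnitaryEnsemble w P M)
    (hw : IsWeight w) (σ : Equiv.Perm (Fin N)) :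
    AEMeasurable (fun ω i => (hM.isHermitian ω).eigenvalues (σ i)) P := by
  obtain ⟨τ, hτ⟩ : ∃ τ : Equiv.Perm (Fin N),
      AEMeasurable (fun ω i => (hM.isHermitian ω).eigenvalues (τ i)) P := by
    by_contra! hcon
    have h := congrArg (fun μ => μ Set.univ) hM.eigenvalueLaw_eq
    simp only [withDensity_apply _ MeasurableSet.univ, Measure.restrict_univ,
      hw.lintegral_jpdf] at h
    rw [eigenvalueLaw, Finset.sum_eq_zero fun τ _ =>
      Measure.map_of_not_aemeasurable (hcon τ)] at h
    simp at h
  rw [aemeasurable_pi_iff] at hτ ⊢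
  intro i
  simpa using hτ (τ⁻¹ (σ i))

/-- By symmetry of `f` all `N !` relabellings give the same integral, so averaging over them changes
nothing. -/
theorem IsUnitaryEnsemble.integrable_integral (hM : IsUnitaryEnsemble w P M) (hw : IsWeight w)
    (f : (Fin N → ℝ) → ℂ) (hf : Continuous f)
    (hsymm : ∀ (σ : Equiv.Perm (Fin N)) x, f (x ∘ σ) = f x)
    (hint : Integrable fun x => f x * (unnormalizedDensity w x : ℂ)) :
    Integrable (fun ω => f (hM.isHermitian ω).eigenvalues) P ∧
    ∫ ω, f (hM.isHermitian ω).eigenvalues ∂P =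
      (∫ x, f x * (unnormalizedDensity w x : ℂ)) / (partitionFunction N w : ℂ) := by
  have hZ := hw.partitionFunction_pos (N := N)
  have hmeas : Measurable fun x : Fin N → ℝ => ENNReal.ofReal (jpdf w x) :=
    (hw.measurable_unnormalizedDensity.div_const _).ennreal_ofReal
  have hreal : ∀ x : Fin N → ℝ, (ENNReal.ofReal (jpdf w x)).toReal • f x =
      f x * (unnormalizedDensity w x : ℂ) / (partitionFunction N w : ℂ) := by
    intro x
    have h0 : 0 ≤ jpdf w x := div_nonneg (hw.unnormalizedDensity_nonneg x) hZ.le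
    rw [ENNReal.toReal_ofReal h0, jpdf,
      Complex.real_smul]
    push_cast
    ring
  have hfin : ∀ᵐ x : Fin N → ℝ, ENNReal.ofReal (jpdf w x) < ∞ :=
    ae_of_all _ fun x => ENNReal.ofReal_lt_top
  have hlaw : Integrable f (eigenvalueLaw P M hM.isHermitian) := by
    rw [hM.eigenvalueLaw_eq, integrable_withDensity_iff_integrable_smul' hmeas hfin]
    simp only [hreal]
    exact hint.div_const _
  have hcomp : ∀ (σ : Equiv.Perm (Fin N)) ω,
      f (fun i => (hM.isHermitian ω).eigenvalues (σ i)) = f (hM.isHermitian ω).eigenvalues :=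
    fun σ ω => hsymm σ (hM.isHermitian ω).eigenvalues
  have hmap : ∀ σ : Equiv.Perm (Fin N),
      Integrable f (P.map fun ω i => (hM.isHermitian ω).eigenvalues (σ i)) := by
    rw [eigenvalueLaw, integrable_smul_measure (by simp) (by simp [Nat.factorial_ne_zero]),
      integrable_finsetSum_measure] at hlaw
    exact fun σ => hlaw σ (Finset.mem_univ _)
  constructor
  · have := (integrable_map_measure hf.aestronglyMeasurable
      (hM.aemeasurable_eigenvalues hw 1)).1 (hmap 1)
    exact this
  · have h1 : ∫ x, f x ∂(eigenvalueLaw P M hM.isHermitian) =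
        ∫ ω, f (hM.isHermitian ω).eigenvalues ∂P := by
      rw [eigenvalueLaw, integral_smul_measure, integral_finsetSum_measure fun σ _ => hmap σ]
      simp only [integral_map (hM.aemeasurable_eigenvalues hw _) hf.aestronglyMeasurable, hcomp]
      have hN : (N ! : ℝ) ≠ 0 := by exact_mod_cast Nat.factorial_ne_zero N
      simp [Fintype.card_perm, Complex.real_smul]
      rw [← mul_assoc, inv_mul_cancel₀ (by exact_mod_cast hN), one_mul]
    rw [← h1, hM.eigenvalueLaw_eq, integral_withDensity_eq_integral_toReal_smul hmeas hfin]
    simp only [hreal]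
    rw [integral_div]

theorem IsUnitaryEnsemble.integrable_integral_det_pow (hM : IsUnitaryEnsemble w P M)
    (hw : IsWeight w) (p : ℕ) (t : ℂ) :
    Integrable (fun ω => (t • (1 : Matrix (Fin N) (Fin N) ℂ) - M ω).det ^ p) P ∧
    ∫ ω, (t • (1 : Matrix (Fin N) (Fin N) ℂ) - M ω).det ^ p ∂P =
      productAverage N w (fun _ : Fin p => t) / (partitionFunction N w : ℂ) := by
  have h := hM.integrable_integral hw (fun x => ∏ i, ∏ _k : Fin p, (t - (x i : ℂ)))
    (by fun_prop)
    (fun σ x => Equiv.prod_comp σ fun i => ∏ _k : Fin p, (t - (x i : ℂ)))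
    (integrable_productAverage hw.moments fun _ : Fin p => t).1
  have e : ∀ ω, (t • (1 : Matrix (Fin N) (Fin N) ℂ) - M ω).det ^ p =
      ∏ i, ∏ _k : Fin p, (t - ((hM.isHermitian ω).eigenvalues i : ℂ)) := by
    intro ω
    rw [det_smul_one_sub_eq_prod (hM.isHermitian ω)]
    simp [Finset.prod_pow]
  simp only [e]
  exact h

end Ensemble

/-! ### The dimension formula -/

/-- The factors continue the smaller factorial up to the larger one. This is the effect of padding a
partition from `l` to `p` parts. -/
theorem prod_filter_le_mul_factorial {p j l : ℕ} (a : ℕ) (hjl : j < l) (hlp : l ≤ p) :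
    (∏ k ∈ Finset.univ.filter (fun k : Fin p => l ≤ (k : ℕ)), ((a : ℝ) - j + (k : ℕ))) *
      ((a + (l - (j + 1)))! : ℝ) = ((a + (p - (j + 1)))! : ℝ) := by
  rw [Finset.prod_filter,
    Fin.prod_univ_eq_prod_range (fun k => if l ≤ k then ((a : ℝ) - j + (k : ℕ)) else 1) p]
  induction p, hlp using Nat.le_induction with
  | base =>
    rw [Finset.prod_eq_one, one_mul]
    intro k hk
    rw [if_neg (not_le.2 (Finset.mem_range.1 hk))]
  | succ p hp ih =>
    rw [Finset.prod_range_succ, if_pos hp, mul_right_comm, ih]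
    have e : a + (p + 1 - (j + 1)) = a + (p - (j + 1)) + 1 := by omega
    rw [e, Nat.factorial_succ]
    push_cast [Nat.cast_sub (show j + 1 ≤ p by omega)]
    ring

theorem ne_zero_iff_lt_length {p : ℕ} {nu : Fin p → ℕ} (h : Antitone nu) (j : Fin p) :
    nu j ≠ 0 ↔ (j : ℕ) < length nu := by
  constructor
  · intro hj
    have hsub : Finset.Iic j ⊆ Finset.univ.filter fun j => nu j ≠ 0 := by
      intro i hi
      have := h (Finset.mem_Iic.1 hi)
      simp only [Finset.mem_filter, Finset.mem_univ, true_and]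
      omega
    have := Finset.card_le_card hsub
    rw [Fin.card_Iic] at this
    exact this
  · intro hj hz
    have hsub : (Finset.univ.filter fun j => nu j ≠ 0) ⊆ Finset.Iio j := by
      intro i hi
      simp only [Finset.mem_filter, Finset.mem_univ, true_and] at hi
      rw [Finset.mem_Iio]
      by_contra hij
      have := h (not_lt.1 hij)
      omega
    have := Finset.card_le_card hsub
    rw [Fin.card_Iio] at this
    exact absurd hj (not_lt.2 this)

theorem length_le {p : ℕ} (nu : Fin p → ℕ) : length nu ≤ p :=
  (Finset.card_filter_le _ _).trans (by simp)

/-- The dimension formula does not depend on the number of zeros appended to the partition. -/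
theorem dimV_div_factorial {p : ℕ} {nu : Fin p → ℕ} (h : Antitone nu) :
    dimV nu / ((weight nu)! : ℝ) =
      (∏ j : Fin p, ∏ k ∈ Finset.Ioi j, ((nu j : ℝ) - nu k - (j : ℕ) + (k : ℕ))) /
        ∏ j : Fin p, ((nu j + (p - ((j : ℕ) + 1)))! : ℝ) := by
  have hw : ((weight nu)! : ℝ) ≠ 0 := by exact_mod_cast Nat.factorial_ne_zero _
  rw [dimV, mul_div_assoc, mul_div_cancel_left₀ _ hw, Finset.prod_filter, ← Finset.prod_div_distrib,
    ← Finset.prod_div_distrib]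
  refine Finset.prod_congr rfl fun j _ => ?_
  -- The factors with `nu k = 0` are the ones that turn the factorial for length `l` into the one
  -- for `p` parts.
  rw [← Finset.prod_filter_mul_prod_filter_not (Finset.Ioi j) fun k => nu k ≠ 0]
  have hzero : ∏ k ∈ (Finset.Ioi j).filter (fun k => ¬ nu k ≠ 0),
      ((nu j : ℝ) - nu k - (j : ℕ) + (k : ℕ)) =
      ∏ k ∈ (Finset.Ioi j).filter (fun k => ¬ nu k ≠ 0), ((nu j : ℝ) - (j : ℕ) + (k : ℕ)) := by
    refine Finset.prod_congr rfl fun k hk => ?_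
    have : nu k = 0 := not_not.1 (Finset.mem_filter.1 hk).2
    simp [this]
  have hfac : ∀ n : ℕ, (n ! : ℝ) ≠ 0 := fun n => by exact_mod_cast Nat.factorial_ne_zero n
  rw [hzero]
  by_cases hj : nu j ≠ 0
  · have hl := (ne_zero_iff_lt_length h j).1 hj
    have e : (Finset.Ioi j).filter (fun k => ¬ nu k ≠ 0) =
        Finset.univ.filter fun k : Fin p => length nu ≤ (k : ℕ) := by
      ext k
      simp only [Finset.mem_filter, Finset.mem_Ioi, Finset.mem_univ, true_and,
        ne_zero_iff_lt_length h k, Fin.lt_def]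
      omega
    rw [if_pos hj, e, ← prod_filter_le_mul_factorial (nu j) hl (length_le nu), mul_comm,
      mul_div_mul_comm, div_self, one_mul]
    rw [Finset.prod_ne_zero_iff]
    intro k hk
    have hk' : length nu ≤ (k : ℕ) := by simpa using hk
    have h1 : ((j : ℕ) : ℝ) < (k : ℕ) := by exact_mod_cast lt_of_lt_of_le hl hk'
    have h2 : (0 : ℝ) ≤ nu j := Nat.cast_nonneg _
    linarith
  · have e : (Finset.Ioi j).filter (fun k => ¬ nu k ≠ 0) =
        Finset.univ.filter fun k : Fin p => (j : ℕ) + 1 ≤ (k : ℕ) := by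
      ext k
      rw [ne_zero_iff_lt_length h j] at hj
      simp only [Finset.mem_filter, Finset.mem_Ioi, Finset.mem_univ, true_and,
        ne_zero_iff_lt_length h k, Fin.lt_def]
      omega
    have h1 := prod_filter_le_mul_factorial (p := p) (nu j) (Nat.lt_succ_self (j : ℕ)) j.isLt
    have hz : nu j = 0 := not_not.1 hj
    simp only [Nat.succ_eq_add_one, Nat.sub_self, add_zero, hz, Nat.factorial_zero,
      Nat.cast_one, mul_one] at h1
    rw [if_neg hj, e, hz, h1, mul_div_cancel_right₀ _ (hfac _), div_one]

theorem prod_prod_sub_eq_prod_factorial (p : ℕ) :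
    ∏ j : Fin p, ∏ k ∈ Finset.Ioi j, (((k : ℕ) : ℝ) - (j : ℕ)) =
      ∏ j : Fin p, ((p - ((j : ℕ) + 1))! : ℝ) := by
  refine Finset.prod_congr rfl fun j _ => ?_
  have h1 := prod_filter_le_mul_factorial (p := p) 0 (Nat.lt_succ_self (j : ℕ)) j.isLt
  have e : Finset.Ioi j = Finset.univ.filter fun k : Fin p => (j : ℕ) + 1 ≤ (k : ℕ) := by
    ext k
    simp only [Finset.mem_filter, Finset.mem_Ioi, Finset.mem_univ, true_and, Fin.lt_def]
    omega
  simp only [Nat.succ_eq_add_one, Nat.sub_self, Nat.factorial_zero, Nat.cast_one,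
    mul_one, Nat.cast_zero, zero_sub, zero_add] at h1
  rw [e, ← h1]
  exact Finset.prod_congr rfl fun k _ => by ring

/-! ### The expectation in terms of orthogonal polynomials -/

/-- If the monic polynomials `Q n`, of degree `n ≥ N`, are orthogonal to all polynomials of lower
degree, the moments of the characteristic polynomial are given by minors of their coefficients. -/
theorem IsUnitaryEnsemble.integral_det_pow_eq_sum {Ω : Type*} [MeasurableSpace Ω] {P : Measure Ω}
    {N : ℕ} {w : ℝ → ℝ} {M : Ω → Matrix (Fin N) (Fin N) ℂ} (hM : IsUnitaryEnsemble w P M)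
    (hw : IsWeight w) (Q : ℕ → Polynomial ℝ)
    (hQ : ∀ n, N ≤ n → (Q n).Monic ∧ (Q n).natDegree = n)
    (horth : ∀ n, N ≤ n → ∀ b, b < n → ∫ y : ℝ, y ^ b * (Q n).eval y * w y = 0)
    (p : ℕ) (t : ℂ) :
    Integrable (fun ω => (t • (1 : Matrix (Fin N) (Fin N) ℂ) - M ω).det ^ p) P ∧
    ∫ ω, (t • (1 : Matrix (Fin N) (Fin N) ℂ) - M ω).det ^ p ∂P =
      ∑ nu ∈ subpartitions N p,
        (((Matrix.of fun j k : Fin p => (Q (N + (p - ((j : ℕ) + 1)))).coeff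
            (nu k + (p - ((k : ℕ) + 1)))).det *
          (dimV nu / ((weight nu)! : ℝ) * ((∏ j : Fin p, ((nu j + (p - ((j : ℕ) + 1)))! : ℝ)) /
            ∏ j : Fin p, ((p - ((j : ℕ) + 1))! : ℝ))) : ℝ) : ℂ) * t ^ weight nu := by
  obtain ⟨hint, heq⟩ := hM.integrable_integral_det_pow hw p t
  refine ⟨hint, ?_⟩
  have hZ : (partitionFunction N w : ℂ) ≠ 0 := by
    exact_mod_cast (hw.partitionFunction_pos (N := N)).ne'
  have h := productAverage_diagonal hw.moments (N := N) t
    (fun j : Fin p => (Q (N + j)).map Complex.ofRealHom)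
    (fun j => ⟨(hQ _ (Nat.le_add_right _ _)).1.map _, by
      rw [Polynomial.natDegree_map]
      exact (hQ _ (Nat.le_add_right _ _)).2⟩)
    (fun i j => by
      have h1 := horth (N + j) (Nat.le_add_right _ _) i (by omega)
      have h2 : ∀ y : ℝ, (y : ℂ) ^ (i : ℕ) *
          ((Q (N + j)).map Complex.ofRealHom).eval (y : ℂ) * (w y : ℂ) =
          ((y ^ (i : ℕ) * (Q (N + j)).eval y * w y : ℝ) : ℂ) := by
        intro y
        have : ((Q (N + j)).map Complex.ofRealHom).eval (y : ℂ) = (((Q (N + j)).eval y : ℝ) : ℂ) :=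
          Polynomial.eval_map_apply (f := Complex.ofRealHom) (x := y)
        rw [this]
        push_cast
        ring
      simp only [h2]
      rw [integral_complex_ofReal, h1, Complex.ofReal_zero])
  rw [heq, h, mul_div_cancel_left₀ _ hZ]
  refine Finset.sum_congr rfl fun nu hnu => ?_
  congr 1
  have hfac : ∀ n : ℕ, (n ! : ℝ) ≠ 0 := fun n => by exact_mod_cast Nat.factorial_ne_zero n
  have hprod : (∏ j : Fin p, ((nu j + (p - ((j : ℕ) + 1)))! : ℝ)) ≠ 0 :=
    Finset.prod_ne_zero_iff.2 fun j _ => hfac _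
  rw [dimV_div_factorial (mem_subpartitions.1 hnu).2, div_mul_div_cancel₀ hprod,
    ← prod_prod_sub_eq_prod_factorial, Complex.ofReal_mul]
  congr 1
  · rw [← Complex.ofRealHom_eq_coe, RingHom.map_det]
    congr 1
    ext j k
    simp [Fin.val_rev]
  · rw [← Finset.prod_div_distrib]
    push_cast
    simp only [← Finset.prod_div_distrib]

theorem det_mul_row_mul_column {p : ℕ} {R : Type*} [CommRing R] (r s : Fin p → R)
    (A : Matrix (Fin p) (Fin p) R) :
    (Matrix.of fun j k => r j * s k * A j k).det = (∏ j, r j) * (∏ k, s k) * A.det := by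
  rw [mul_assoc, ← Matrix.det_mul_row, ← Matrix.det_mul_column]
  congr 1
  ext j k
  simp [mul_assoc]

/-! ### Classical orthogonal polynomials -/

/-- This is the `n`-th forward difference of `R` at `0`. The binomial is written with factorials so
that it splits into row and column factors in the minors. -/
theorem sum_alternating_eval_eq_zero {n : ℕ} (R : Polynomial ℝ) (hR : R.natDegree < n) :
    ∑ m ∈ Finset.range (n + 1), (-1 : ℝ) ^ (n + m) * ((n ! : ℝ) / ((m ! : ℝ) * ((n - m)! : ℝ))) *
      R.eval (m : ℝ) = 0 := by
  have h := congrFun (Polynomial.fwdDiff_iter_eq_zero_of_degree_lt hR) 0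
  rw [fwdDiff_iter_eq_sum_shift] at h
  rw [Pi.zero_apply] at h
  rw [← h]
  refine Finset.sum_congr rfl fun m hm => ?_
  have hmn : m ≤ n := Nat.lt_succ_iff.1 (Finset.mem_range.1 hm)
  have hs : (-1 : ℝ) ^ (n + m) = (-1) ^ (n - m) := by
    rw [show n + m = n - m + 2 * m by omega, pow_add, pow_mul]
    simp
  rw [hs, ← Nat.cast_choose ℝ hmn]
  simp

/-- The polynomial of degree `n` with coefficients `(-1) ^ (n + m) * n.choose m * a m`. -/
def alternatingPolynomial (n : ℕ) (a : ℕ → ℝ) : Polynomial ℝ :=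
  ∑ m ∈ Finset.range (n + 1), Polynomial.monomial m
    ((-1 : ℝ) ^ (n + m) * ((n ! : ℝ) / ((m ! : ℝ) * ((n - m)! : ℝ))) * a m)

theorem coeff_alternatingPolynomial (n : ℕ) (a : ℕ → ℝ) (m : ℕ) :
    (alternatingPolynomial n a).coeff m = if m ≤ n then
      (-1 : ℝ) ^ (n + m) * ((n ! : ℝ) / ((m ! : ℝ) * ((n - m)! : ℝ))) * a m else 0 := by
  simp only [alternatingPolynomial, Polynomial.finsetSum_coeff, Polynomial.coeff_monomial]
  rw [Finset.sum_ite_eq']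
  simp

theorem monic_alternatingPolynomial {n : ℕ} {a : ℕ → ℝ} (ha : a n = 1) :
    (alternatingPolynomial n a).Monic ∧ (alternatingPolynomial n a).natDegree = n := by
  have hc : (alternatingPolynomial n a).coeff n = 1 := by
    have : (n ! : ℝ) ≠ 0 := by exact_mod_cast Nat.factorial_ne_zero n
    rw [coeff_alternatingPolynomial, if_pos le_rfl, ha, ← two_mul, pow_mul]
    simp [this]
  have hd : (alternatingPolynomial n a).natDegree ≤ n := by
    rw [Polynomial.natDegree_le_iff_coeff_eq_zero]
    intro m hm
    rw [coeff_alternatingPolynomial, if_neg (not_le.2 hm)]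
  exact ⟨Polynomial.monic_of_natDegree_le_of_coeff_eq_one n hd hc,
    le_antisymm hd (Polynomial.le_natDegree_of_ne_zero (by rw [hc]; exact one_ne_zero))⟩

/-- Integrating term by term leaves an alternating binomial sum of a polynomial in the index `m`;
`K` collects what is independent of `m`. -/
theorem integral_pow_mul_alternatingPolynomial_eq_zero {w : ℝ → ℝ} (hw : IsWeight w) {n b : ℕ}
    {a : ℕ → ℝ} (K : ℝ) (R : Polynomial ℝ) (hR : R.natDegree < n)
    (h : ∀ m ≤ n, a m * ∫ y : ℝ, y ^ (m + b) * w y = K * R.eval (m : ℝ)) :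
    ∫ y : ℝ, y ^ b * (alternatingPolynomial n a).eval y * w y = 0 := by
  have e : ∀ y : ℝ, y ^ b * (alternatingPolynomial n a).eval y * w y =
      ∑ m ∈ Finset.range (n + 1),
        ((-1 : ℝ) ^ (n + m) * ((n ! : ℝ) / ((m ! : ℝ) * ((n - m)! : ℝ))) * a m) *
          (y ^ (m + b) * w y) := by
    intro y
    simp only [alternatingPolynomial, Polynomial.eval_finsetSum, Polynomial.eval_monomial,
      Finset.mul_sum, Finset.sum_mul]
    exact Finset.sum_congr rfl fun m _ => by ring
  simp only [e]
  rw [integral_finsetSum _ fun m _ => (hw.moments _).const_mul _]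
  simp only [integral_const_mul]
  rw [← mul_zero K, ← sum_alternating_eval_eq_zero R hR, Finset.mul_sum]
  refine Finset.sum_congr rfl fun m hm => ?_
  rw [mul_assoc, h m (Nat.lt_succ_iff.1 (Finset.mem_range.1 hm))]
  ring

theorem Gamma_add_natCast {x : ℝ} (hx : 0 < x) (n : ℕ) :
    Real.Gamma (x + n) = Real.Gamma x * (ascPochhammer ℝ n).eval x := by
  induction n with
  | zero => simp
  | succ n ih =>
    rw [ascPochhammer_succ_eval, ← mul_assoc, ← ih]
    push_cast
    rw [← add_assoc, Real.Gamma_add_one (by positivity)]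
    ring

/-- The shifted rising factorial. -/
def shiftedPochhammer (s : ℝ) (n : ℕ) : Polynomial ℝ :=
  (ascPochhammer ℝ n).comp (Polynomial.X + Polynomial.C s)

theorem natDegree_shiftedPochhammer (s : ℝ) (n : ℕ) : (shiftedPochhammer s n).natDegree = n := by
  rw [shiftedPochhammer, Polynomial.natDegree_comp, ascPochhammer_natDegree,
    Polynomial.natDegree_X_add_C, mul_one]

theorem eval_shiftedPochhammer (s x : ℝ) (n : ℕ) :
    (shiftedPochhammer s n).eval x = (ascPochhammer ℝ n).eval (x + s) := by
  simp [shiftedPochhammer]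

/-! #### The Laguerre weight -/

theorem pow_mul_laguerreWeight (γ : ℝ) (k : ℕ) : (fun y => y ^ k * laguerreWeight γ y) =
    Set.indicator (Set.Ioi 0) fun y => Real.exp (-y) * y ^ ((k : ℝ) + γ + 1 - 1) := by
  funext y
  rw [laguerreWeight]
  by_cases hy : y ∈ Set.Ioi (0 : ℝ)
  · rw [Set.indicator_of_mem hy, Set.indicator_of_mem hy, add_sub_cancel_right,
      Real.rpow_add hy, Real.rpow_natCast]
    ring
  · rw [Set.indicator_of_notMem hy, Set.indicator_of_notMem hy, mul_zero]

theorem isWeight_laguerreWeight {γ : ℝ} (hγ : -1 < γ) : IsWeight (laguerreWeight γ) where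
  measurable := by
    refine Measurable.indicator ?_ measurableSet_Ioi
    fun_prop
  nonneg x := by
    refine Set.indicator_nonneg (fun y hy => ?_) x
    exact mul_nonneg (Real.rpow_nonneg (le_of_lt hy) _) (Real.exp_nonneg _)
  pos x hx := by
    rw [laguerreWeight, Set.indicator_of_mem (Set.mem_Ioi.2 hx.1)]
    exact mul_pos (Real.rpow_pos_of_pos hx.1 _) (Real.exp_pos _)
  moments k := by
    rw [pow_mul_laguerreWeight, integrable_indicator_iff measurableSet_Ioi]
    have : (0 : ℝ) ≤ k := Nat.cast_nonneg k
    exact Real.GammaIntegral_convergent (by linarith)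

theorem integral_pow_mul_laguerreWeight {γ : ℝ} (hγ : -1 < γ) (k : ℕ) :
    ∫ y, y ^ k * laguerreWeight γ y = Real.Gamma (k + γ + 1) := by
  have : (0 : ℝ) ≤ k := Nat.cast_nonneg k
  rw [pow_mul_laguerreWeight, integral_indicator measurableSet_Ioi,
    Real.Gamma_eq_integral (by linarith)]

/-- The monic Laguerre polynomials. -/
def monicLaguerre (γ : ℝ) (n : ℕ) : Polynomial ℝ :=
  alternatingPolynomial n fun m => Real.Gamma (n + γ + 1) / Real.Gamma (m + γ + 1)

theorem Gamma_natCast_add_pos {γ : ℝ} (hγ : -1 < γ) (m : ℕ) : 0 < Real.Gamma (m + γ + 1) := by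
  have : (0 : ℝ) ≤ m := Nat.cast_nonneg m
  exact Real.Gamma_pos_of_pos (by linarith)

/-- The ratio `Γ(m + b + γ + 1) / Γ(m + γ + 1)` is a rising factorial, of degree `b < n` in `m`. -/
theorem integral_pow_mul_monicLaguerre {γ : ℝ} (hγ : -1 < γ) {n b : ℕ} (hb : b < n) :
    ∫ y : ℝ, y ^ b * (monicLaguerre γ n).eval y * laguerreWeight γ y = 0 := by
  refine integral_pow_mul_alternatingPolynomial_eq_zero (isWeight_laguerreWeight hγ)
    (Real.Gamma (n + γ + 1)) (shiftedPochhammer (γ + 1) b)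
    (by rwa [natDegree_shiftedPochhammer]) fun m _ => ?_
  have hm : (0 : ℝ) ≤ m := Nat.cast_nonneg m
  have h := Gamma_add_natCast (x := m + γ + 1) (by linarith) b
  have h0 := (Gamma_natCast_add_pos hγ m).ne'
  rw [integral_pow_mul_laguerreWeight hγ, eval_shiftedPochhammer, ← add_assoc]
  push_cast
  rw [show (m : ℝ) + b + γ + 1 = m + γ + 1 + b by ring, h]
  field_simp

/-! #### The Jacobi weight -/

theorem ofReal_beta_integrand {u v x : ℝ} (hx : x ∈ Set.Ioc (0 : ℝ) 1) :
    ((x ^ (u - 1) * (1 - x) ^ (v - 1) : ℝ) : ℂ) =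
      (x : ℂ) ^ ((u : ℂ) - 1) * (1 - (x : ℂ)) ^ ((v : ℂ) - 1) := by
  rw [Complex.ofReal_mul, Complex.ofReal_cpow hx.1.le, Complex.ofReal_cpow (sub_nonneg.2 hx.2)]
  push_cast
  rfl

theorem integrableOn_beta_integrand {u v : ℝ} (hu : 0 < u) (hv : 0 < v) :
    IntegrableOn (fun x : ℝ => x ^ (u - 1) * (1 - x) ^ (v - 1)) (Set.Ioc 0 1) := by
  have h := Complex.betaIntegral_convergent (u := u) (v := v) (by simpa) (by simpa)
  rw [intervalIntegrable_iff_integrableOn_Ioc_of_le zero_le_one] at h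
  have h2 : IntegrableOn (fun x : ℝ => (((x ^ (u - 1) * (1 - x) ^ (v - 1) : ℝ)) : ℂ))
      (Set.Ioc 0 1) :=
    h.congr_fun (fun x hx => (ofReal_beta_integrand hx).symm) measurableSet_Ioc
  have h3 := h2.re
  simp only [RCLike.re_to_complex, Complex.ofReal_re] at h3
  exact h3

theorem setIntegral_beta_integrand {u v : ℝ} (hu : 0 < u) (hv : 0 < v) :
    ∫ x in Set.Ioc (0 : ℝ) 1, x ^ (u - 1) * (1 - x) ^ (v - 1) =
      Real.Gamma u * Real.Gamma v / Real.Gamma (u + v) := by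
  have h := Complex.Gamma_mul_Gamma_eq_betaIntegral (s := u) (t := v) (by simpa) (by simpa)
  rw [Complex.betaIntegral, intervalIntegral.integral_of_le zero_le_one,
    ← setIntegral_congr_fun measurableSet_Ioc fun x hx => ofReal_beta_integrand hx,
    integral_complex_ofReal, ← Complex.ofReal_add, Complex.Gamma_ofReal, Complex.Gamma_ofReal,
    Complex.Gamma_ofReal] at h
  have h' : Real.Gamma u * Real.Gamma v =
      Real.Gamma (u + v) * ∫ x in Set.Ioc (0 : ℝ) 1, x ^ (u - 1) * (1 - x) ^ (v - 1) := by
    exact_mod_cast h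
  rw [h', mul_div_cancel_left₀ _ (Real.Gamma_pos_of_pos (add_pos hu hv)).ne']

/-- Only almost everywhere: the weight includes the endpoint `0`, which `Ioc 0 1` omits, and
`Real.rpow_add` needs a positive base. -/
theorem pow_mul_jacobiWeight (γ₁ γ₂ : ℝ) (k : ℕ) :
    (fun y => y ^ k * jacobiWeight γ₁ γ₂ y) =ᵐ[volume] Set.indicator (Set.Ioc 0 1) fun y =>
      y ^ ((k : ℝ) + γ₁ + 1 - 1) * (1 - y) ^ (γ₂ + 1 - 1) := by
  filter_upwards [compl_mem_ae_iff.2 (measure_singleton (μ := volume) (0 : ℝ))] with y hy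
  have hy0 : y ≠ 0 := hy
  rw [jacobiWeight]
  by_cases h : y ∈ Set.Ioc (0 : ℝ) 1
  · rw [Set.indicator_of_mem h, Set.indicator_of_mem (Set.Ioc_subset_Icc_self h),
      add_sub_cancel_right, add_sub_cancel_right, Real.rpow_add h.1, Real.rpow_natCast]
    ring
  · rw [Set.indicator_of_notMem h, Set.indicator_of_notMem, mul_zero]
    exact fun h' => h ⟨lt_of_le_of_ne h'.1 hy0.symm, h'.2⟩

theorem isWeight_jacobiWeight {γ₁ γ₂ : ℝ} (h₁ : -1 < γ₁) (h₂ : -1 < γ₂) :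
    IsWeight (jacobiWeight γ₁ γ₂) where
  measurable := by
    refine Measurable.indicator ?_ measurableSet_Icc
    fun_prop
  nonneg x := by
    refine Set.indicator_nonneg (fun y hy => ?_) x
    exact mul_nonneg (Real.rpow_nonneg hy.1 _) (Real.rpow_nonneg (sub_nonneg.2 hy.2) _)
  pos x hx := by
    rw [jacobiWeight, Set.indicator_of_mem (Set.Ioo_subset_Icc_self hx)]
    exact mul_pos (Real.rpow_pos_of_pos hx.1 _) (Real.rpow_pos_of_pos (sub_pos.2 hx.2) _)
  moments k := by
    rw [integrable_congr (pow_mul_jacobiWeight γ₁ γ₂ k), integrable_indicator_iff measurableSet_Ioc]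
    have : (0 : ℝ) ≤ k := Nat.cast_nonneg k
    exact integrableOn_beta_integrand (by linarith) (by linarith)

theorem integral_pow_mul_jacobiWeight {γ₁ γ₂ : ℝ} (h₁ : -1 < γ₁) (h₂ : -1 < γ₂) (k : ℕ) :
    ∫ y, y ^ k * jacobiWeight γ₁ γ₂ y =
      Real.Gamma (k + γ₁ + 1) * Real.Gamma (γ₂ + 1) / Real.Gamma (k + γ₁ + 1 + (γ₂ + 1)) := by
  have : (0 : ℝ) ≤ k := Nat.cast_nonneg k
  rw [integral_congr_ae (pow_mul_jacobiWeight γ₁ γ₂ k), integral_indicator measurableSet_Ioc,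
    setIntegral_beta_integrand (by linarith) (by linarith)]

/-- The monic Jacobi polynomials on the unit interval. -/
def monicJacobi (γ₁ γ₂ : ℝ) (n : ℕ) : Polynomial ℝ :=
  alternatingPolynomial n fun m =>
    Real.Gamma (n + γ₁ + 1) * Real.Gamma (n + m + γ₁ + γ₂ + 1) /
      (Real.Gamma (m + γ₁ + 1) * Real.Gamma (2 * n + γ₁ + γ₂ + 1))

/-- Coefficient and Beta moment combine into `Γ(m + b + γ₁ + 1) / Γ(m + γ₁ + 1)` and `Γ(n + m + γ₁ +
γ₂ + 1) / Γ(m + b + γ₁ + γ₂ + 2)`. These are rising factorials in `m` of degrees `b` and `e = n - 1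
- b`, so the total degree is `n - 1`. -/
theorem integral_pow_mul_monicJacobi {γ₁ γ₂ : ℝ} (h₁ : -1 < γ₁) (h₂ : -1 < γ₂) {n b : ℕ}
    (hb : b < n) :
    ∫ y : ℝ, y ^ b * (monicJacobi γ₁ γ₂ n).eval y * jacobiWeight γ₁ γ₂ y = 0 := by
  obtain ⟨e, rfl⟩ := Nat.exists_eq_add_of_lt hb
  refine integral_pow_mul_alternatingPolynomial_eq_zero (isWeight_jacobiWeight h₁ h₂)
    (Real.Gamma ((b + e + 1 : ℕ) + γ₁ + 1) / Real.Gamma (2 * (b + e + 1 : ℕ) + γ₁ + γ₂ + 1) *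
      Real.Gamma (γ₂ + 1))
    (shiftedPochhammer (γ₁ + 1) b * shiftedPochhammer (b + γ₁ + γ₂ + 2) e) ?_ fun m _ => ?_
  · refine lt_of_le_of_lt Polynomial.natDegree_mul_le ?_
    rw [natDegree_shiftedPochhammer, natDegree_shiftedPochhammer]
    omega
  have hm : (0 : ℝ) ≤ m := Nat.cast_nonneg m
  have hb0 : (0 : ℝ) ≤ b := Nat.cast_nonneg b
  have g1 := Gamma_add_natCast (x := m + γ₁ + 1) (by linarith) b
  have g2 := Gamma_add_natCast (x := m + b + γ₁ + γ₂ + 2) (by linarith) e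
  have n1 := (Gamma_natCast_add_pos h₁ m).ne'
  have n2 : Real.Gamma (m + b + γ₁ + γ₂ + 2) ≠ 0 :=
    (Real.Gamma_pos_of_pos (by linarith)).ne'
  rw [integral_pow_mul_jacobiWeight h₁ h₂, Polynomial.eval_mul, eval_shiftedPochhammer,
    eval_shiftedPochhammer]
  have c1 : ((m + b : ℕ) : ℝ) + γ₁ + 1 = m + γ₁ + 1 + b := by push_cast; ring
  have c2 : (m : ℝ) + γ₁ + 1 + b + (γ₂ + 1) = m + b + γ₁ + γ₂ + 2 := by ring
  have c3 : ((b + e + 1 : ℕ) : ℝ) + m + γ₁ + γ₂ + 1 = m + b + γ₁ + γ₂ + 2 + e := by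
    push_cast; ring
  have c4 : (m : ℝ) + (γ₁ + 1) = m + γ₁ + 1 := by ring
  have c5 : (m : ℝ) + (b + γ₁ + γ₂ + 2) = m + b + γ₁ + γ₂ + 2 := by ring
  rw [c1, c2, c3, c4, c5, g1, g2]
  field_simp

theorem monic_monicLaguerre {γ : ℝ} (hγ : -1 < γ) (n : ℕ) :
    (monicLaguerre γ n).Monic ∧ (monicLaguerre γ n).natDegree = n :=
  monic_alternatingPolynomial (div_self (Gamma_natCast_add_pos hγ n).ne')

/-- The case `n = 0` must be excluded: if `γ₁ + γ₂ = -1`, then `Real.Gamma 0 = 0` makes the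
polynomial zero. -/
theorem monic_monicJacobi {γ₁ γ₂ : ℝ} (h₁ : -1 < γ₁) (h₂ : -1 < γ₂) {n : ℕ} (hn : 1 ≤ n) :
    (monicJacobi γ₁ γ₂ n).Monic ∧ (monicJacobi γ₁ γ₂ n).natDegree = n := by
  refine monic_alternatingPolynomial ?_
  have hn' : (1 : ℝ) ≤ n := by exact_mod_cast hn
  have n1 := (Gamma_natCast_add_pos h₁ n).ne'
  have n2 : Real.Gamma (2 * n + γ₁ + γ₂ + 1) ≠ 0 :=
    (Real.Gamma_pos_of_pos (by linarith)).ne'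
  rw [← two_mul, div_self (mul_ne_zero n1 n2)]

/-! #### The Gaussian weight -/

theorem isWeight_gaussianWeight : IsWeight gaussianWeight where
  measurable := by
    unfold gaussianWeight
    fun_prop
  nonneg x := Real.exp_nonneg _
  pos x _ := Real.exp_pos _
  moments k := by
    have h := integrable_rpow_mul_exp_neg_mul_sq (b := 1 / 2) (by norm_num) (s := k)
      (lt_of_lt_of_le (by norm_num) (Nat.cast_nonneg k))
    refine h.congr (ae_of_all _ fun y => ?_)
    simp only [Real.rpow_natCast, gaussianWeight]
    congr 2
    ring

theorem integrable_eval_mul_gaussianWeight (F : Polynomial ℝ) :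
    Integrable fun y => F.eval y * gaussianWeight y := by
  simp only [Polynomial.eval_eq_sum_range, Finset.sum_mul, mul_assoc]
  exact integrable_finsetSum _ fun k _ => (isWeight_gaussianWeight.moments k).const_mul _

/-- Gaussian integration by parts, from `w' = -y w`. -/
theorem integral_X_mul_gaussianWeight (F : Polynomial ℝ) :
    ∫ y, (Polynomial.X * F).eval y * gaussianWeight y =
      ∫ y, F.derivative.eval y * gaussianWeight y := by
  have h := integral_eq_zero_of_hasDerivAt_of_integrable
    (f := fun y => F.eval y * gaussianWeight y)
    (f' := fun y => F.derivative.eval y * gaussianWeight y -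
      (Polynomial.X * F).eval y * gaussianWeight y)
    (fun y => by
      have h1 : HasDerivAt gaussianWeight (gaussianWeight y * (-y)) y := by
        unfold gaussianWeight
        refine HasDerivAt.exp ?_
        have := ((hasDerivAt_pow 2 y).neg).div_const 2
        convert! this using 1
        norm_num
        ring
      have h2 := (F.hasDerivAt y).mul h1
      convert! h2 using 1
      simp
      ring)
    ((integrable_eval_mul_gaussianWeight _).sub (integrable_eval_mul_gaussianWeight _))
    (integrable_eval_mul_gaussianWeight _)
  rw [integral_sub (integrable_eval_mul_gaussianWeight _)
    (integrable_eval_mul_gaussianWeight _)] at h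
  exact (sub_eq_zero.1 h).symm

/-- The Hermite polynomials with real coefficients. -/
def realHermite (n : ℕ) : Polynomial ℝ := (Polynomial.hermite n).map (Int.castRingHom ℝ)

theorem integral_realHermite_succ_mul (n : ℕ) (F : Polynomial ℝ) :
    ∫ y, (realHermite (n + 1) * F).eval y * gaussianWeight y =
      ∫ y, (realHermite n * F.derivative).eval y * gaussianWeight y := by
  have e : realHermite (n + 1) * F =
      Polynomial.X * (realHermite n * F) - (realHermite n).derivative * F := by
    simp only [realHermite, Polynomial.hermite_succ, Polynomial.map_sub, Polynomial.map_mul,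
      Polynomial.map_X, Polynomial.derivative_map]
    ring
  simp only [e, Polynomial.eval_sub, sub_mul]
  rw [integral_sub (integrable_eval_mul_gaussianWeight _) (integrable_eval_mul_gaussianWeight _),
    integral_X_mul_gaussianWeight, ← integral_sub (integrable_eval_mul_gaussianWeight _)
      (integrable_eval_mul_gaussianWeight _)]
  congr 1
  funext y
  simp only [Polynomial.derivative_mul, Polynomial.eval_add, Polynomial.eval_mul]
  ring

/-- Each integration by parts lowers the Hermite index and differentiates the monomial, which dies
before the index is exhausted. -/
theorem integral_pow_mul_realHermite {n b : ℕ} (hb : b < n) :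
    ∫ y : ℝ, y ^ b * (realHermite n).eval y * gaussianWeight y = 0 := by
  have key : ∀ (n b : ℕ), b < n →
      ∫ y, (realHermite n * Polynomial.X ^ b).eval y * gaussianWeight y = 0 := by
    intro n
    induction n with
    | zero => intro b hb; exact absurd hb (Nat.not_lt_zero _)
    | succ n ih =>
      intro b hb
      rw [integral_realHermite_succ_mul]
      rcases b with _ | b
      · simp
      · have h := ih b (by omega)
        rw [Polynomial.derivative_X_pow]
        have e : ∀ y : ℝ, (realHermite n * (Polynomial.C ((b + 1 : ℕ) : ℝ) *
            Polynomial.X ^ (b + 1 - 1))).eval y * gaussianWeight y =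
            ((b + 1 : ℕ) : ℝ) * ((realHermite n * Polynomial.X ^ b).eval y *
              gaussianWeight y) := by
          intro y
          simp only [Polynomial.eval_mul, Polynomial.eval_C, Nat.add_sub_cancel]
          ring
        simp only [e]
        rw [integral_const_mul, h, mul_zero]
  rw [← key n b hb]
  congr 1
  funext y
  simp only [Polynomial.eval_mul, Polynomial.eval_pow, Polynomial.eval_X]
  ring

theorem monic_realHermite (n : ℕ) : (realHermite n).Monic ∧ (realHermite n).natDegree = n := by
  refine ⟨(Polynomial.hermite_monic n).map _, ?_⟩
  rw [realHermite, (Polynomial.hermite_monic n).natDegree_map, Polynomial.natDegree_hermite]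

theorem coeff_realHermite (n m : ℕ) : (realHermite n).coeff m =
    if m ≤ n ∧ Even (n - m) then
      (n ! : ℝ) / (m ! : ℝ) * ((-1 / 2) ^ ((n - m) / 2) / (((n - m) / 2)! : ℝ)) else 0 := by
  rw [realHermite, Polynomial.coeff_map]
  split_ifs with h
  · obtain ⟨k, hk⟩ := h.2
    have hn : n = 2 * k + m := by omega
    subst hn
    have hf : ∀ n : ℕ, (n ! : ℝ) ≠ 0 := fun n => by exact_mod_cast Nat.factorial_ne_zero n
    have hd : ((2 * k)! : ℝ) = ((2 * k - 1)‼ : ℝ) * (2 ^ k * (k ! : ℝ)) := by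
      -- The case `k = 0` is separate because `2 * k - 1` truncates.
      rcases k with _ | k
      · simp
      · have h1 := Nat.factorial_eq_mul_doubleFactorial (2 * k + 1)
        have h2 := Nat.doubleFactorial_two_mul (k + 1)
        rw [show 2 * (k + 1) = 2 * k + 1 + 1 by ring] at h2 ⊢
        rw [h1, h2]
        push_cast
        ring
    rw [Polynomial.coeff_hermite_explicit, Nat.add_sub_cancel,
      Nat.mul_div_cancel_left _ (by norm_num)]
    simp only [eq_intCast]
    push_cast
    rw [Nat.cast_choose ℝ (Nat.le_add_left m (2 * k)), Nat.add_sub_cancel, hd, div_pow]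
    have hdf : ((2 * k - 1)‼ : ℝ) ≠ 0 := by
      exact_mod_cast (Nat.doubleFactorial_pos _).ne'
    have := hf k
    have := hf m
    field_simp
  · rw [eq_intCast, Int.cast_eq_zero]
    by_cases hmn : m ≤ n
    · refine Polynomial.coeff_hermite_of_odd_add ?_
      rw [← Nat.not_even_iff_odd]
      intro he
      refine h ⟨hmn, ?_⟩
      rwa [Nat.even_sub hmn, ← Nat.even_add]
    · exact Polynomial.coeff_hermite_of_lt (not_le.1 hmn)

/-! ### Minors of the coefficients -/

/-- The entry `lam_j + n - j` of the strictly decreasing sequence attached to a partition. -/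
def shifted {n : ℕ} (lam : Fin n → ℕ) (j : Fin n) : ℕ := lam j + (n - ((j : ℕ) + 1))

section Shifted

variable {p : ℕ} (lam nu : Fin p → ℕ)

theorem shift_eq_sub (j k : Fin p) :
    shift lam nu j k = (shifted lam j : ℤ) - (shifted nu k : ℤ) := by
  have hj := j.isLt
  have hk := k.isLt
  unfold shift shifted
  omega

theorem shift_nonneg_iff (j k : Fin p) :
    0 ≤ shift lam nu j k ↔ shifted nu k ≤ shifted lam j := by
  rw [shift_eq_sub]
  omega

theorem cast_shifted (j : Fin p) :
    ((shifted lam j : ℕ) : ℝ) = (lam j : ℝ) + (p : ℝ) - (((j : ℕ) : ℝ) + 1) := by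
  have hj : (j : ℕ) + 1 ≤ p := j.isLt
  rw [shifted]
  push_cast [Nat.cast_sub hj]
  ring

theorem G_eq_prod (γ : ℝ) : G lam γ = ∏ j : Fin p, Real.Gamma ((shifted lam j : ℕ) + γ + 1) := by
  simp only [G, cast_shifted]

theorem G_zero_eq_prod : G lam 0 = ∏ j : Fin p, ((shifted lam j)! : ℝ) := by
  rw [G_eq_prod]
  refine Finset.prod_congr rfl fun j _ => ?_
  rw [add_zero, Real.Gamma_nat_eq_factorial]

theorem sum_shifted_sub_sum_shifted :
    ∑ j, shifted lam j - ∑ k, shifted nu k = weight lam - weight nu := by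
  simp only [shifted, Finset.sum_add_distrib, weight]
  omega

theorem sum_shifted : ∑ j, shifted lam j = weight lam + ∑ j : Fin p, (p - ((j : ℕ) + 1)) := by
  simp only [shifted, Finset.sum_add_distrib, weight]

end Shifted

/-- The staircase `∑ (p - j)` occurs in both exponents and cancels modulo 2; moreover `p (p + N -
1)` and `p N` have the same parity. -/
theorem prod_neg_one_pow_shifted {N p : ℕ} (nu : Fin p → ℕ) :
    (∏ j, (-1 : ℝ) ^ shifted (rect N p) j) * ∏ k, (-1 : ℝ) ^ shifted nu k =
      (-1) ^ (p * (p + N - 1)) * (-1) ^ weight nu := by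
  simp only [Finset.prod_pow_eq_pow_sum, sum_shifted, pow_add]
  have h1 : ((-1 : ℝ) ^ ∑ j : Fin p, (p - ((j : ℕ) + 1))) *
      (-1 : ℝ) ^ ∑ j : Fin p, (p - ((j : ℕ) + 1)) = 1 := by
    rw [← mul_pow]
    simp
  have h2 : weight (rect N p) = p * N := by
    simp [weight, rect]
  have h3 : (-1 : ℝ) ^ (p * (p + N - 1)) = (-1) ^ (p * N) := by
    rcases Nat.eq_zero_or_pos p with rfl | hp
    · simp
    · have e : p * (p + N - 1) = p * (p - 1) + p * N := by
        rw [← mul_add]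
        congr 1
        omega
      rw [e, pow_add, (Nat.even_mul_pred_self p).neg_one_pow, one_mul]
  rw [h2, h3, mul_mul_mul_comm, mul_assoc, h1]
  ring

/-- In a Leibniz term with all conditions met, the differences `n (σ i) - m i` are even and their
sum does not depend on `σ`. So the power of `x` is common to all terms, and no term survives if the
total is odd. -/
theorem det_even_sub_mul_pow {p : ℕ} (n m : Fin p → ℕ) (x : ℝ) (f : ℕ → ℝ) :
    (Matrix.of fun j k => if m k ≤ n j ∧ Even (n j - m k) then
      x ^ ((n j - m k) / 2) * f ((n j - m k) / 2) else 0).det =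
    x ^ ((∑ j, n j - ∑ k, m k) / 2) * (Matrix.of fun j k =>
      if m k ≤ n j ∧ Even (n j - m k) then f ((n j - m k) / 2) else 0).det ∧
    (¬ Even (∑ j, n j - ∑ k, m k) → (Matrix.of fun j k =>
      if m k ≤ n j ∧ Even (n j - m k) then f ((n j - m k) / 2) else 0).det = 0) := by
  have hsum : ∀ σ : Equiv.Perm (Fin p), (∀ i, m i ≤ n (σ i) ∧ Even (n (σ i) - m i)) →
      ∑ j, n j - ∑ k, m k = 2 * ∑ i, (n (σ i) - m i) / 2 := by
    intro σ h
    rw [← Equiv.sum_comp σ n, Nat.sub_eq_iff_eq_add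
      (Finset.sum_le_sum fun i _ => (h i).1), Finset.mul_sum, ← Finset.sum_add_distrib]
    refine Finset.sum_congr rfl fun i _ => ?_
    have := (h i).1
    rw [Nat.two_mul_div_two_of_even (h i).2]
    omega
  rw [Matrix.det_apply', Matrix.det_apply', Finset.mul_sum]
  simp only [Matrix.of_apply]
  constructor
  · refine Finset.sum_congr rfl fun σ _ => ?_
    by_cases h : ∀ i, m i ≤ n (σ i) ∧ Even (n (σ i) - m i)
    · rw [hsum σ h, Nat.mul_div_cancel_left _ (by norm_num), ← Finset.prod_pow_eq_pow_sum,
        mul_left_comm, ← Finset.prod_mul_distrib]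
      congr 1
      exact Finset.prod_congr rfl fun i _ => by rw [if_pos (h i), if_pos (h i)]
    · obtain ⟨i, hi⟩ := not_forall.1 h
      rw [Finset.prod_eq_zero (Finset.mem_univ i) (if_neg hi),
        Finset.prod_eq_zero (Finset.mem_univ i) (if_neg hi)]
      simp
  · intro hodd
    refine Finset.sum_eq_zero fun σ _ => ?_
    by_cases h : ∀ i, m i ≤ n (σ i) ∧ Even (n (σ i) - m i)
    · exact absurd (by rw [hsum σ h]; exact even_two_mul _) hodd
    · obtain ⟨i, hi⟩ := not_forall.1 h
      rw [Finset.prod_eq_zero (Finset.mem_univ i) (if_neg hi), mul_zero]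

theorem DHermite_eq_det {p : ℕ} (lam nu : Fin p → ℕ) :
    DHermite lam nu = (Matrix.of fun j k => if shifted nu k ≤ shifted lam j ∧
      Even (shifted lam j - shifted nu k) then
        (1 : ℝ) / (((shifted lam j - shifted nu k) / 2)! : ℝ) else 0).det := by
  rw [DHermite]
  congr 1
  ext j k
  simp only [Matrix.of_apply]
  by_cases h : shifted nu k ≤ shifted lam j
  · have e : shift lam nu j k = ((shifted lam j - shifted nu k : ℕ) : ℤ) := by
      rw [shift_eq_sub, Nat.cast_sub h]
    have e2 : (((shifted lam j - shifted nu k : ℕ) : ℤ) / 2).toNat =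
        (shifted lam j - shifted nu k) / 2 := by omega
    simp only [e, e2, Int.even_coe_nat, h, true_and, Int.natCast_nonneg]
  · rw [if_neg fun h' => h ((shift_nonneg_iff lam nu j k).1 h'.1), if_neg fun h' => h h'.1]

variable {N p : ℕ}

theorem det_coeff_realHermite (nu : Fin p → ℕ) :
    (Matrix.of fun j k : Fin p =>
      (realHermite (shifted (rect N p) j)).coeff (shifted nu k)).det =
    (∏ j, ((shifted (rect N p) j)! : ℝ)) * (∏ k, 1 / ((shifted nu k)! : ℝ)) *
      ((-1 / 2) ^ ((weight (rect N p) - weight nu) / 2) * DHermite (rect N p) nu) := by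
  rw [DHermite_eq_det, ← sum_shifted_sub_sum_shifted,
    ← (det_even_sub_mul_pow _ _ _ fun d => 1 / (d ! : ℝ)).1, ← det_mul_row_mul_column]
  congr 1
  ext j k
  simp only [Matrix.of_apply, coeff_realHermite]
  split_ifs
  · ring
  · ring

theorem det_coeff_monicLaguerre (γ : ℝ) (nu : Fin p → ℕ) :
    (Matrix.of fun j k : Fin p =>
      (monicLaguerre γ (shifted (rect N p) j)).coeff (shifted nu k)).det =
    (-1) ^ (p * (p + N - 1)) * (-1) ^ weight nu * (G (rect N p) 0 * G (rect N p) γ) /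
      (G nu 0 * G nu γ) * DLaguerre (rect N p) nu := by
  have h := det_mul_row_mul_column
    (fun j => (-1) ^ shifted (rect N p) j * ((shifted (rect N p) j)! : ℝ) *
      Real.Gamma ((shifted (rect N p) j : ℕ) + γ + 1))
    (fun k => (-1) ^ shifted nu k / ((shifted nu k)! : ℝ) /
      Real.Gamma ((shifted nu k : ℕ) + γ + 1))
    (Matrix.of fun j k : Fin p =>
      if 0 ≤ shift (rect N p) nu j k then
        (1 : ℝ) / (((shift (rect N p) nu j k).toNat)! : ℝ) else 0)
  simp only [Finset.prod_mul_distrib, Finset.prod_div_distrib, ← G_eq_prod,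
    ← G_zero_eq_prod] at h
  rw [← prod_neg_one_pow_shifted, DLaguerre]
  refine Eq.trans ?_ (h.trans ?_)
  · congr 1
    ext j k
    simp only [Matrix.of_apply, monicLaguerre, coeff_alternatingPolynomial,
      shift_nonneg_iff]
    by_cases hle : shifted nu k ≤ shifted (rect N p) j
    · have e : (shift (rect N p) nu j k).toNat = shifted (rect N p) j - shifted nu k := by
        rw [shift_eq_sub]
        omega
      rw [if_pos hle, if_pos hle, e, pow_add]
      ring
    · rw [if_neg hle, if_neg hle, mul_zero]
  · ring

/-- Unlike in the Laguerre case, `Γ(n + m + γ₁ + γ₂ + 1)` mixes row and column and stays inside the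
determinant; `Γ(2n + γ₁ + γ₂ + 1)` leaves as a row factor. -/
theorem det_coeff_monicJacobi (γ₁ γ₂ : ℝ) (nu : Fin p → ℕ) :
    (Matrix.of fun j k : Fin p =>
      (monicJacobi γ₁ γ₂ (shifted (rect N p) j)).coeff (shifted nu k)).det =
    (∏ j ∈ Finset.Ico N (p + N), 1 / Real.Gamma (2 * (j : ℝ) + γ₁ + γ₂ + 1)) *
      ((-1) ^ (p * (p + N - 1)) * (-1) ^ weight nu * (G (rect N p) 0 * G (rect N p) γ₁) /
        (G nu 0 * G nu γ₁)) * DJacobi γ₁ γ₂ (rect N p) nu := by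
  have h := det_mul_row_mul_column
    (fun j => (-1) ^ shifted (rect N p) j * ((shifted (rect N p) j)! : ℝ) *
      Real.Gamma ((shifted (rect N p) j : ℕ) + γ₁ + 1) /
      Real.Gamma (2 * (shifted (rect N p) j : ℕ) + γ₁ + γ₂ + 1))
    (fun k => (-1) ^ shifted nu k / ((shifted nu k)! : ℝ) /
      Real.Gamma ((shifted nu k : ℕ) + γ₁ + 1))
    (Matrix.of fun j k : Fin p =>
      if 0 ≤ shift (rect N p) nu j k then
        Real.Gamma (2 * (p : ℝ) + (rect N p j : ℝ) + (nu k : ℝ) - (((j : ℕ) : ℝ) + 1)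
          - (((k : ℕ) : ℝ) + 1) + γ₁ + γ₂ + 1) /
          (((shift (rect N p) nu j k).toNat)! : ℝ) else 0)
  -- The shifted parts of the rectangle are `N, …, N + p - 1` in decreasing order.
  have hIco : ∏ j ∈ Finset.Ico N (p + N), 1 / Real.Gamma (2 * (j : ℝ) + γ₁ + γ₂ + 1) =
      1 / ∏ j, Real.Gamma (2 * ((shifted (rect N p) j : ℕ) : ℝ) + γ₁ + γ₂ + 1) := by
    rw [one_div, ← Finset.prod_inv_distrib, Finset.prod_Ico_eq_prod_range, Nat.add_sub_cancel,
      Finset.prod_range fun i => 1 / Real.Gamma (2 * ((N + i : ℕ) : ℝ) + γ₁ + γ₂ + 1)]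
    refine Fintype.prod_equiv Fin.revPerm _ _ fun i => ?_
    have e : shifted (rect N p) i.rev = N + i := by
      have := i.isLt
      simp only [shifted, rect, Fin.val_rev]
      omega
    simp [e]
  simp only [Finset.prod_mul_distrib, Finset.prod_div_distrib, ← G_eq_prod,
    ← G_zero_eq_prod] at h
  rw [← prod_neg_one_pow_shifted, DJacobi, hIco]
  refine Eq.trans ?_ (h.trans ?_)
  · congr 1
    ext j k
    simp only [Matrix.of_apply, monicJacobi, coeff_alternatingPolynomial,
      shift_nonneg_iff]
    by_cases hle : shifted nu k ≤ shifted (rect N p) j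
    · have e : (shift (rect N p) nu j k).toNat = shifted (rect N p) j - shifted nu k := by
        rw [shift_eq_sub]
        omega
      have e2 : 2 * (p : ℝ) + (rect N p j : ℝ) + (nu k : ℝ) - (((j : ℕ) : ℝ) + 1)
          - (((k : ℕ) : ℝ) + 1) + γ₁ + γ₂ + 1 =
          ((shifted (rect N p) j : ℕ) : ℝ) + ((shifted nu k : ℕ) : ℝ) + γ₁ + γ₂ + 1 := by
        rw [cast_shifted, cast_shifted]
        ring
      rw [if_pos hle, if_pos hle, e, e2, pow_add]
      ring
    · rw [if_neg hle, if_neg hle, mul_zero]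
  · ring

end UnitaryEnsemble

end

/-! ### The three ensembles. -/

open UnitaryEnsemble in
theorem mainTheorem8 {Ω : Type*} [MeasurableSpace Ω] (P : Measure Ω) [IsProbabilityMeasure P]
    (N p : ℕ) (hN : 1 ≤ N) (M : Ω → Matrix (Fin N) (Fin N) ℂ) (t : ℂ) :
    (IsGUE P M →
      Integrable (fun ω => (t • (1 : Matrix (Fin N) (Fin N) ℂ) - M ω).det ^ p) P ∧
      ∫ ω, (t • (1 : Matrix (Fin N) (Fin N) ℂ) - M ω).det ^ p ∂P =
        (C (rect N p) : ℂ) *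
          ∑ nu ∈ (subpartitions N p).filter
              (fun nu => Even (weight (rect N p) - weight nu)),
            (-1 / 2 : ℂ) ^ ((weight (rect N p) - weight nu) / 2) *
              ((dimV nu / ((weight nu)! : ℝ) * DHermite (rect N p) nu : ℝ) : ℂ) *
              t ^ weight nu) ∧
    (∀ γ : ℝ, -1 < γ → IsLUE γ P M →
      Integrable (fun ω => (t • (1 : Matrix (Fin N) (Fin N) ℂ) - M ω).det ^ p) P ∧
      ∫ ω, (t • (1 : Matrix (Fin N) (Fin N) ℂ) - M ω).det ^ p ∂P =
        (-1 : ℂ) ^ (p * (p + N - 1)) *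
          ((G (rect N p) γ * (G (rect N p) 0 / G (rect 0 p) 0) : ℝ) : ℂ) *
          ∑ nu ∈ subpartitions N p,
            (((-1) ^ weight nu / (((weight nu)! : ℝ) * G nu γ) * dimV nu *
              DLaguerre (rect N p) nu : ℝ) : ℂ) * t ^ weight nu) ∧
    (∀ γ₁ γ₂ : ℝ, -1 < γ₁ → -1 < γ₂ → IsJUE γ₁ γ₂ P M →
      Integrable (fun ω => (t • (1 : Matrix (Fin N) (Fin N) ℂ) - M ω).det ^ p) P ∧
      ∫ ω, (t • (1 : Matrix (Fin N) (Fin N) ℂ) - M ω).det ^ p ∂P =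
        ((∏ j ∈ Finset.Ico N (p + N), 1 / Real.Gamma (2 * (j : ℝ) + γ₁ + γ₂ + 1) : ℝ) : ℂ) *
          (-1 : ℂ) ^ (p * (p + N - 1)) *
          ((G (rect N p) γ₁ * G (rect N p) 0 / G (rect 0 p) 0 : ℝ) : ℂ) *
          ∑ nu ∈ subpartitions N p,
            (((-1) ^ weight nu / (((weight nu)! : ℝ) * G nu γ₁) * dimV nu *
              DJacobi γ₁ γ₂ (rect N p) nu : ℝ) : ℂ) * t ^ weight nu) := by
  have hprod : ∀ nu : Fin p → ℕ, (∏ j, ((shifted nu j)! : ℝ)) ≠ 0 := fun nu =>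
    Finset.prod_ne_zero_iff.2 fun j _ => by exact_mod_cast Nat.factorial_ne_zero _
  have hG0 : ∀ nu : Fin p → ℕ, G nu 0 ≠ 0 := fun nu => by
    rw [G_zero_eq_prod]
    exact hprod nu
  have hrect : G (rect 0 p) 0 = ∏ j : Fin p, ((p - ((j : ℕ) + 1))! : ℝ) := by
    rw [G_zero_eq_prod]
    simp [shifted, rect]
  have hsign : ∀ k : ℕ, (-1 : ℂ) ^ k = (((-1 : ℝ) ^ k : ℝ) : ℂ) := fun k => by push_cast; rfl
  refine ⟨fun hM => ?_, fun γ hγ hM => ?_, fun γ₁ γ₂ h₁ h₂ hM => ?_⟩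
  · obtain ⟨hint, h⟩ := hM.integral_det_pow_eq_sum isWeight_gaussianWeight realHermite
      (fun n _ => monic_realHermite n) (fun n _ b hb => integral_pow_mul_realHermite hb) p t
    refine ⟨hint, h.trans ?_⟩
    rw [Finset.mul_sum, ← Finset.sum_filter_of_ne (s := subpartitions N p)
      (p := fun nu => Even (weight (rect N p) - weight nu))]
    · refine Finset.sum_congr rfl fun nu _ => ?_
      have hd := det_coeff_realHermite (N := N) nu
      have e : (-1 / 2 : ℂ) = ((-1 / 2 : ℝ) : ℂ) := by push_cast; rfl
      simp only [shifted, rect] at hd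
      rw [hd, e, ← Complex.ofReal_pow]
      refine Eq.trans ?_ (mul_assoc _ _ _)
      simp only [← Complex.ofReal_mul]
      congr 2
      have h0 := hprod nu
      simp only [shifted] at h0
      rw [C, Finset.prod_div_distrib, Finset.prod_div_distrib, Finset.prod_const_one]
      simp only [rect]
      field_simp
    · intro nu _ hne
      by_contra hodd
      refine hne ?_
      have hd := det_coeff_realHermite (N := N) nu
      -- Only the vanishing for odd total is used, so the base `1` is arbitrary.
      have h0 := (det_even_sub_mul_pow (shifted (rect N p)) (shifted nu) 1
        fun d => 1 / (d ! : ℝ)).2 (by rwa [sum_shifted_sub_sum_shifted])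
      rw [← DHermite_eq_det] at h0
      rw [h0, mul_zero, mul_zero] at hd
      simp only [shifted, rect] at hd
      rw [hd, zero_mul, Complex.ofReal_zero, zero_mul]
  · obtain ⟨hint, h⟩ := hM.integral_det_pow_eq_sum (isWeight_laguerreWeight hγ) (monicLaguerre γ)
      (fun n _ => monic_monicLaguerre hγ n)
      (fun n _ b hb => integral_pow_mul_monicLaguerre hγ hb) p t
    refine ⟨hint, h.trans ?_⟩
    rw [Finset.mul_sum]
    refine Finset.sum_congr rfl fun nu _ => ?_
    have hd := det_coeff_monicLaguerre (N := N) γ nu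
    have h0 := hG0 nu
    -- The factorials in `G nu 0` cancel those coming from the Schur polynomial at equal arguments.
    rw [G_zero_eq_prod nu] at hd h0
    simp only [shifted, rect] at hd h0
    rw [hd, hsign, hrect]
    refine Eq.trans ?_ (mul_assoc _ _ _)
    simp only [← Complex.ofReal_mul]
    congr 2
    field_simp
  · obtain ⟨hint, h⟩ := hM.integral_det_pow_eq_sum (isWeight_jacobiWeight h₁ h₂)
      -- Only degrees `n ≥ N ≥ 1` occur, which avoids the degenerate Jacobi polynomial of degree
      -- zero.
      (monicJacobi γ₁ γ₂) (fun n hn => monic_monicJacobi h₁ h₂ (hN.trans hn))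
      (fun n _ b hb => integral_pow_mul_monicJacobi h₁ h₂ hb) p t
    refine ⟨hint, h.trans ?_⟩
    rw [Finset.mul_sum]
    refine Finset.sum_congr rfl fun nu _ => ?_
    have hd := det_coeff_monicJacobi (N := N) γ₁ γ₂ nu
    have h0 := hG0 nu
    rw [G_zero_eq_prod nu] at hd h0
    simp only [shifted, rect] at hd h0
    rw [hd, hsign, hrect]
    refine Eq.trans ?_ (mul_assoc _ _ _)
    simp only [← Complex.ofReal_mul]
    congr 2
    field_simp
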